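/- Let $f_1,\dots,f_N$ be similarities of $\mathbb R^d$ with contraction ratios $\lambda_1,\dots,\lambda_N\in(0,1)$ satisfying the open set condition: there is a non-empty bounded open set $U$ with $f_i(U)\subseteq U$ for all $i$ and $f_i(U)\cap f_j(U)=\emptyset$ for $i\ne j$. Let $\Lambda$ be the attractor, i.e. the unique non-empty compact set with $\Lambda=\bigcup_i f_i(\Lambda)$, and put $s_0=\dim_H\Lambda$. Let $\Sigma=\{1,\dots,N\}^{\mathbb N}$ with the left shift $\sigma$ and the coding map $\pi(i_1i_2\dots)=\lim_{n\to\infty}f_{i_1}\circ\dots\circ f_{i_n}(0)$; for a finite word $w$ let $[w]\subseteq\Sigma$ be the set of sequences with initial segment $w$, and let $x|_m$ denote the first $m$ letters of $x$. Let $p=(p_1,\dots,p_N)$ be a probability vector with all $p_i>0$, let $p_{\min}=\min_i p_i$, and let $\mathbb P_p$ be the corresponding Bernoulli (product) measure on $\Sigma$. Let $\alpha>0$ and let $\ell:\mathbb N\to\mathbb N$ be non-decreasing with $$\liminf_{n\to\infty}\frac{\ell(n)}{\log n}=\frac1\alpha .$$ For $\bar o\in\Sigma$ define $$R(\bar o,\ell)=\pi\Big(\bigcap_{k\ge1}\bigcup_{n\ge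 k}\big[(\sigma^n\bar o)|_{\ell(n)}\big]\Big)\subseteq\Lambda,\qquad R(\bar o,\ell)^c=\Lambda\setminus R(\bar o,\ell),$$ and for $q\in\mathbb R$ let $P_\alpha(q)$ be the unique real number with $\sum_{i=1}^N\lambda_i^{P_\alpha(q)}(p_ie^\alpha)^q=1$. Then for $\mathbb P_p$-almost every $\bar o\in\Sigma$ the following hold. 1. If $\alpha<-\log p_{\min}$, then $\dim_H R(\bar o,\ell)^c=\inf_{q<0}P_\alpha(q)$. 2. If $\alpha<-\sum_{i=1}^N\lambda_i^{s_0}\log p_i$, then $\mathcal H^{s_0}(R(\bar o,\ell)^c)=\mathcal H^{s_0}(\Lambda)$. 3. If $\alpha>-\log p_{\min}$, then $R(\bar o,\ell)^c=\emptyset$, and $\inf_{q<0}P_\alpha(q)=-\infty$ (so the formula of part 1 remains valid with the convention $\dim_H\emptyset=-\infty$). -/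

import Mathlib

open MeasureTheory Filter Topology
open scoped NNReal ENNReal

/-- The Euclidean space `ℝ^d`. -/
abbrev RSpace (d : ℕ) : Type := EuclideanSpace ℝ (Fin d)

/-- The map `f` is a similarity of `ℝ^d` with ratio `lam`. -/
def IsSimilarity {d : ℕ} (f : RSpace d → RSpace d) (lam : ℝ) : Prop :=
  ∀ x y, dist (f x) (f y) = lam * dist x y

/-- The open set condition: some non-empty bounded open set `U` contains all its images `f i (U)`,
and these images are pairwise disjoint. -/
def OpenSetCondition {d N : ℕ} (f : Fin N → RSpace d → RSpace d) : Prop :=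
  ∃ U : Set (RSpace d), IsOpen U ∧ Bornology.IsBounded U ∧ U.Nonempty ∧
    (∀ i, f i '' U ⊆ U) ∧ ∀ i j, i ≠ j → Disjoint (f i '' U) (f j '' U)

/-- `L` is the attractor of the iterated function system `f`: the (unique) non-empty compact set
which is the union of its images. -/
def IsAttractor {d N : ℕ} (f : Fin N → RSpace d → RSpace d) (L : Set (RSpace d)) : Prop :=
  L.Nonempty ∧ IsCompact L ∧ L = ⋃ i, f i '' L

/-- The symbolic space of infinite words over an alphabet with `N` letters. -/
abbrev SymbolSpace (N : ℕ) : Type := ℕ → Fin N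

/-- The left shift. -/
def shift {N : ℕ} (ω : SymbolSpace N) : SymbolSpace N := fun k => ω (k + 1)

/-- `wordMap f ω n` is the composition `f (ω 0) ∘ ⋯ ∘ f (ω (n - 1))` along the first `n` letters
of `ω`. -/
def wordMap {d N : ℕ} (f : Fin N → RSpace d → RSpace d) (ω : SymbolSpace N) :
    ℕ → RSpace d → RSpace d
  | 0 => id
  | n + 1 => wordMap f ω n ∘ f (ω n)

/-- The coding map `π(ω) = lim_n f_{ω|n}(0)`; the limit exists for contracting similarities, see
`tendsto_codingMap`. -/
noncomputable def codingMap {d N : ℕ} (f : Fin N → RSpace d → RSpace d) (ω : SymbolSpace N) :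
    RSpace d :=
  limUnder atTop (fun n => wordMap f ω n 0)

/-- The dynamical covering set: the points having a coding which lies in the cylinder
`[(σ^n o)|_{ℓ(n)}]` for infinitely many `n`.
(`PiNat.cylinder x m` is the set of sequences which agree with `x` in the first `m` letters.) -/
def dynamicalCoveringSet {d N : ℕ} (f : Fin N → RSpace d → RSpace d) (o : SymbolSpace N)
    (l : ℕ → ℕ) : Set (RSpace d) :=
  codingMap f '' {ω | ∃ᶠ n in atTop, ω ∈ PiNat.cylinder (shift^[n] o) (l n)}

/-- The measure on the alphabet giving mass `p i` to the letter `i`. -/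
noncomputable def letterMeasure {N : ℕ} (p : Fin N → ℝ) : Measure (Fin N) :=
  ∑ i, ENNReal.ofReal (p i) • Measure.dirac i

/-- The Bernoulli measure of a probability vector `p`: the infinite product measure under which
the letters are independent with law `p`. -/
noncomputable def bernoulliMeasure {N : ℕ} (p : Fin N → ℝ) : Measure (SymbolSpace N) :=
  Measure.infinitePi (fun _ : ℕ => letterMeasure p)

/-- The sum `∑ λ_i^s (p_i e^α)^q`. -/
noncomputable def pressureSum {N : ℕ} (lam p : Fin N → ℝ) (α q s : ℝ) : ℝ :=
  ∑ i, lam i ^ s * (p i * Real.exp α) ^ q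

/-- The pressure `P_α(q)`: the solution `s` of `∑ λ_i^s (p_i e^α)^q = 1`, which exists and is
unique, see `existsUnique_pressureSum_eq_one`. -/
noncomputable def pressure {N : ℕ} (lam p : Fin N → ℝ) (α q : ℝ) : ℝ :=
  Classical.epsilon fun s => pressureSum lam p α q s = 1

/-- The smallest entry of `p`. -/
noncomputable def minProb {N : ℕ} (p : Fin N → ℝ) : ℝ := ⨅ i, p i

theorem isProbabilityMeasure_letterMeasure {N : ℕ} {p : Fin N → ℝ} (hp : ∀ i, 0 < p i)
    (hp1 : ∑ i, p i = 1) : IsProbabilityMeasure (letterMeasure p) := by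
  constructor
  simp only [letterMeasure, Measure.coe_finsetSum, Finset.sum_apply, Measure.smul_apply,
    measure_univ, smul_eq_mul, mul_one]
  rw [← ENNReal.ofReal_sum_of_nonneg fun i _ => (hp i).le, hp1, ENNReal.ofReal_one]

theorem existsUnique_pressureSum_eq_one {N : ℕ} [NeZero N] {lam p : Fin N → ℝ}
    (h0 : ∀ i, 0 < lam i) (h1 : ∀ i, lam i < 1) (hp : ∀ i, 0 < p i) (α q : ℝ) :
    ∃! s, pressureSum lam p α q s = 1 := by
  have hc : ∀ i, 0 < (p i * Real.exp α) ^ q := fun i =>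
    Real.rpow_pos_of_pos (mul_pos (hp i) (Real.exp_pos α)) q
  have hcont : Continuous (pressureSum lam p α q) := by
    refine continuous_finsetSum _ fun i _ => ?_
    exact (Real.continuous_const_rpow (h0 i).ne').mul continuous_const
  have hanti : StrictAnti (pressureSum lam p α q) := by
    intro s t hst
    refine Finset.sum_lt_sum_of_nonempty ⟨0, Finset.mem_univ _⟩ fun i _ => ?_
    exact mul_lt_mul_of_pos_right (Real.rpow_lt_rpow_of_exponent_gt (h0 i) (h1 i) hst) (hc i)
  have htop : Tendsto (pressureSum lam p α q) atTop (𝓝 0) := by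
    have : Tendsto (pressureSum lam p α q) atTop (𝓝 (∑ i : Fin N, 0 * (p i * Real.exp α) ^ q)) := by
      refine tendsto_finsetSum _ fun i _ => ?_
      exact (tendsto_rpow_atTop_of_base_lt_one (lam i) (by linarith [h0 i]) (h1 i)).mul_const _
    simpa using this
  have hbot : Tendsto (pressureSum lam p α q) atBot atTop := by
    refine tendsto_atTop_mono (f := fun s => lam 0 ^ s * (p 0 * Real.exp α) ^ q) (fun s => ?_) ?_
    · exact Finset.single_le_sum (f := fun i => lam i ^ s * (p i * Real.exp α) ^ q)
        (fun i _ => (mul_pos (Real.rpow_pos_of_pos (h0 i) s) (hc i)).le) (Finset.mem_univ _)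
    · exact (tendsto_rpow_atBot_of_base_lt_one (lam 0) (h0 0) (h1 0)).atTop_mul_const (hc 0)
  obtain ⟨a, ha⟩ := (hbot.eventually (eventually_ge_atTop 1)).exists
  obtain ⟨b, hb⟩ := (htop.eventually (eventually_le_nhds zero_lt_one)).exists
  obtain ⟨s, hs⟩ := mem_range_of_exists_le_of_exists_ge hcont ⟨b, hb⟩ ⟨a, ha⟩
  exact ⟨s, hs, fun t ht => hanti.injective (ht.trans hs.symm)⟩

theorem pressureSum_pressure {N : ℕ} [NeZero N] {lam p : Fin N → ℝ}
    (h0 : ∀ i, 0 < lam i) (h1 : ∀ i, lam i < 1) (hp : ∀ i, 0 < p i) (α q : ℝ) :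
    pressureSum lam p α q (pressure lam p α q) = 1 :=
  Classical.epsilon_spec (existsUnique_pressureSum_eq_one h0 h1 hp α q).exists

theorem dist_wordMap_le {d N : ℕ} {f : Fin N → RSpace d → RSpace d} {lam : Fin N → ℝ} {K : ℝ}
    (hK : 0 ≤ K) (hlam : ∀ i, lam i ≤ K) (hf : ∀ i, IsSimilarity (f i) (lam i))
    (ω : SymbolSpace N) (n : ℕ) (x y : RSpace d) :
    dist (wordMap f ω n x) (wordMap f ω n y) ≤ K ^ n * dist x y := by
  induction n generalizing x y with
  | zero => simp [wordMap]
  | succ n ih =>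
    calc dist (wordMap f ω n (f (ω n) x)) (wordMap f ω n (f (ω n) y))
        ≤ K ^ n * dist (f (ω n) x) (f (ω n) y) := ih _ _
      _ ≤ K ^ n * (K * dist x y) := by
          rw [hf (ω n) x y]
          gcongr
          exact hlam _
      _ = K ^ (n + 1) * dist x y := by ring

theorem tendsto_codingMap {d N : ℕ} {f : Fin N → RSpace d → RSpace d} {lam : Fin N → ℝ}
    (h1 : ∀ i, lam i < 1) (hf : ∀ i, IsSimilarity (f i) (lam i)) (ω : SymbolSpace N) :
    Tendsto (fun n => wordMap f ω n 0) atTop (𝓝 (codingMap f ω)) := by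
  obtain ⟨K, hK0, hK1, hK⟩ : ∃ K : ℝ, 0 ≤ K ∧ K < 1 ∧ ∀ i, lam i ≤ K := by
    have hne : (Finset.univ : Finset (Fin N)).Nonempty := ⟨ω 0, Finset.mem_univ _⟩
    refine ⟨max 0 (Finset.univ.sup' hne lam), le_max_left _ _, ?_, fun i => ?_⟩
    · rw [max_lt_iff, Finset.sup'_lt_iff]
      exact ⟨zero_lt_one, fun i _ => h1 i⟩
    · exact (Finset.le_sup' lam (Finset.mem_univ i)).trans (le_max_right _ _)
  have hcauchy : CauchySeq fun n => wordMap f ω n (0 : RSpace d) := by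
    refine cauchySeq_of_le_geometric K (∑ i, dist 0 (f i 0)) hK1 fun n => ?_
    calc dist (wordMap f ω n 0) (wordMap f ω n (f (ω n) 0))
        ≤ K ^ n * dist 0 (f (ω n) 0) := dist_wordMap_le hK0 hK hf ω n _ _
      _ ≤ K ^ n * ∑ i, dist 0 (f i 0) := by
          gcongr
          exact Finset.single_le_sum (f := fun i => dist (0 : RSpace d) (f i 0))
            (fun i _ => dist_nonneg) (Finset.mem_univ _)
      _ = (∑ i, dist 0 (f i 0)) * K ^ n := mul_comm _ _
  exact hcauchy.tendsto_limUnder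

/-! Everything is read off from the symbolic space: the question is which sequences are covered only
finitely often, and how small `p` is on their initial segments.

Upper bounds. A word of length `m` and probability at least `e^{-am}` is very unlikely to be missing
from the first `e^{bm}` letters of `o` when `a < b`. Union bound and Borel-Cantelli give
`ae_eventually_forall_exists_hit`: almost surely all such words occur in time. Since `l` is monotone
and `b * l n ≤ log n` infinitely often for `b < α`, a sequence that is not covered infinitely often
must satisfy `p(ω|m) < e^{-am}` for infinitely many `m`, for every nonnegative `a < α`
(`ae_frequently_wordProd_lt_of_not_covered`). If `α > -log p_min`, taking `a = -log p_min` is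
absurd, so nothing is uncovered. Otherwise the bad cylinders are used as covers. For `q ≤ 0` each
bad word has `(p(w) e^{am})^q ≥ 1`, so the `s`-sum over the bad words of length `m` is at most the
`m`-th power of the pressure sum, and the tails vanish when that sum is below `1`
(`hausdorffMeasure_frequently_lt_eq_zero`).

Lower bounds. Let `m` be a weight vector with `-∑ m_i log p_i > α`. By the law of large numbers
`m`-typical sequences have `p(ω|k) ≤ e^{-ak}` with some `a > α`, so the hitting probabilities
`p(ω|l(n))` are summable. Borel-Cantelli and Fubini show that for almost every `o`, `m`-almost every
sequence is covered finitely often (`ae_ae_not_covered_of_lt`). For the dimension formula, `m` is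
the normalised vector `λ_i^s (p_i e^{α'})^q` at the `q` minimising the pressure sum on `q ≤ 0`, with
`α'` slightly above `α` (`exists_weights`). The open set condition gives a mass distribution
principle (`le_dimH_of_ae_mem`). A point may have several codings, and only one of them need be
covered. The remedy is a word whose infinite recurrence forces the coding to be unique
(`OpenSetCondition.exists_word_unique_coding`), which typical sequences contain infinitely often.
For the measure statement `m_i = λ_i^{s₀}`: the covered sequences are null for this Bernoulli
measure, which dominates `H^{s₀}` after projection (`hausdorffMeasure_image_codingMap_le`). -/

/-! ### Words, concatenation, and products along words -/

/-- The product `v (ω 0) ⋯ v (ω (n - 1))` of the values of `v` along the first `n` letters. -/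
noncomputable def wordProd {N : ℕ} (v : Fin N → ℝ) (ω : SymbolSpace N) (n : ℕ) : ℝ :=
  ∏ k ∈ Finset.range n, v (ω k)

/-- The sequence consisting of the first `n` letters of `ω` followed by `η`. -/
def splice {N : ℕ} (ω : SymbolSpace N) (n : ℕ) (η : SymbolSpace N) : SymbolSpace N :=
  fun k => if k < n then ω k else η (k - n)

section Words

variable {N : ℕ} {v : Fin N → ℝ} {ω η : SymbolSpace N} {m n : ℕ}

theorem shift_iterate_apply (ω : SymbolSpace N) (n k : ℕ) : (shift^[n] ω) k = ω (n + k) := by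
  induction n generalizing ω with
  | zero => simp
  | succ n ih => rw [Function.iterate_succ_apply, ih]; simp only [shift]; congr 1; ring

theorem splice_apply_of_lt {k : ℕ} (h : k < n) : splice ω n η k = ω k := if_pos h

theorem splice_apply_add (k : ℕ) : splice ω n η (n + k) = η k := by simp [splice]

theorem shift_iterate_splice : shift^[n] (splice ω n η) = η := by
  funext k; rw [shift_iterate_apply, splice_apply_add]

theorem splice_shift_iterate : splice ω n (shift^[n] ω) = ω := by
  funext k
  by_cases h : k < n
  · exact splice_apply_of_lt h
  · simp only [splice, h, if_false, shift_iterate_apply]; congr 1; omega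

theorem splice_mem_cylinder : splice ω n η ∈ PiNat.cylinder ω n :=
  fun _ h => splice_apply_of_lt h

theorem wordProd_zero : wordProd v ω 0 = 1 := by simp [wordProd]

theorem wordProd_succ : wordProd v ω (n + 1) = wordProd v ω n * v (ω n) :=
  Finset.prod_range_succ _ _

theorem wordProd_pos (hv : ∀ i, 0 < v i) (ω : SymbolSpace N) (n : ℕ) : 0 < wordProd v ω n :=
  Finset.prod_pos fun _ _ => hv _

theorem wordProd_congr (h : ω ∈ PiNat.cylinder η n) : wordProd v ω n = wordProd v η n :=
  Finset.prod_congr rfl fun k hk => by rw [h k (Finset.mem_range.1 hk)]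

theorem wordProd_splice_add :
    wordProd v (splice ω n η) (n + m) = wordProd v ω n * wordProd v η m := by
  rw [wordProd, Finset.prod_range_add]
  congr 1
  · exact wordProd_congr splice_mem_cylinder
  · exact Finset.prod_congr rfl fun k _ => by rw [splice_apply_add]

theorem wordProd_antitone (h0 : ∀ i, 0 < v i) (h1 : ∀ i, v i ≤ 1) (ω : SymbolSpace N) :
    Antitone (wordProd v ω) :=
  antitone_nat_of_succ_le fun n => by
    rw [wordProd_succ]
    exact mul_le_of_le_one_right (wordProd_pos h0 ω n).le (h1 _)

theorem wordProd_le_one (h0 : ∀ i, 0 < v i) (h1 : ∀ i, v i ≤ 1) (ω : SymbolSpace N) (n : ℕ) :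
    wordProd v ω n ≤ 1 := by
  simpa [wordProd_zero] using wordProd_antitone h0 h1 ω (Nat.zero_le n)

theorem wordProd_mul (u v : Fin N → ℝ) (ω : SymbolSpace N) (n : ℕ) :
    wordProd (fun i => u i * v i) ω n = wordProd u ω n * wordProd v ω n :=
  Finset.prod_mul_distrib

theorem wordProd_rpow (hv : ∀ i, 0 < v i) (s : ℝ) (ω : SymbolSpace N) (n : ℕ) :
    wordProd (fun i => v i ^ s) ω n = wordProd v ω n ^ s :=
  Real.finsetProd_rpow _ _ (fun _ _ => (hv _).le) _

theorem wordProd_const (c : ℝ) (ω : SymbolSpace N) (n : ℕ) :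
    wordProd (fun _ => c) ω n = c ^ n := by
  simp [wordProd]

theorem wordProd_mono {u v : Fin N → ℝ} (hu : ∀ i, 0 ≤ u i) (h : ∀ i, u i ≤ v i)
    (ω : SymbolSpace N) (n : ℕ) : wordProd u ω n ≤ wordProd v ω n :=
  Finset.prod_le_prod (fun _ _ => hu _) fun _ _ => h _

theorem log_wordProd (hv : ∀ i, 0 < v i) (ω : SymbolSpace N) (n : ℕ) :
    Real.log (wordProd v ω n) = ∑ k ∈ Finset.range n, Real.log (v (ω k)) :=
  Real.log_prod fun _ _ => (hv _).ne'

theorem exists_forall_le_lt_one [NeZero N] (h1 : ∀ i, v i < 1) : ∃ K < 1, 0 < K ∧ ∀ i, v i ≤ K := by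
  obtain ⟨i, hi⟩ := Finite.exists_max v
  exact ⟨max (v i) (1 / 2), max_lt (h1 i) (by norm_num), lt_max_of_lt_right (by norm_num),
    fun j => le_max_of_le_left (hi j)⟩

theorem exists_pos_forall_le [NeZero N] (h0 : ∀ i, 0 < v i) : ∃ c > 0, ∀ i, c ≤ v i := by
  obtain ⟨i, hi⟩ := Finite.exists_min v
  exact ⟨v i, h0 i, hi⟩

theorem tendsto_wordProd_zero (h0 : ∀ i, 0 < v i) (h1 : ∀ i, v i < 1) (ω : SymbolSpace N) :
    Tendsto (wordProd v ω) atTop (𝓝 0) := by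
  have : NeZero N := ⟨fun h => by subst h; exact (ω 0).elim0⟩
  obtain ⟨K, hK1, hK0, hK⟩ := exists_forall_le_lt_one h1
  refine squeeze_zero (fun n => (wordProd_pos h0 ω n).le) (fun n => ?_)
    (tendsto_pow_atTop_nhds_zero_of_lt_one hK0.le hK1)
  rw [← wordProd_const K ω n]
  exact wordProd_mono (fun i => (h0 i).le) hK ω n

theorem measurable_wordProd (v : Fin N → ℝ) (n : ℕ) : Measurable fun ω => wordProd v ω n := by
  unfold wordProd
  exact Finset.measurable_fun_prod _ fun k _ =>
    (measurable_of_finite v).comp (measurable_pi_apply k)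

theorem sum_prod_words (v : Fin N → ℝ) (m : ℕ) :
    ∑ w : Fin m → Fin N, ∏ k, v (w k) = (∑ i, v i) ^ m := by
  rw [← Fintype.piFinset_univ, ← Finset.prod_univ_sum]; simp

/-- An infinite continuation of a finite word. -/
def extendWord [NeZero N] {m : ℕ} (w : Fin m → Fin N) : SymbolSpace N :=
  fun k => if h : k < m then w ⟨k, h⟩ else 0

theorem extendWord_apply [NeZero N] {m : ℕ} (w : Fin m → Fin N) (k : Fin m) :
    extendWord w k = w k := by simp [extendWord]

theorem extendWord_restrict_mem_cylinder [NeZero N] (ω : SymbolSpace N) (m : ℕ) :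
    extendWord (fun k : Fin m => ω k) ∈ PiNat.cylinder ω m := fun k hk => by
  simp [extendWord, hk]

theorem wordProd_extendWord [NeZero N] {m : ℕ} (w : Fin m → Fin N) :
    wordProd v (extendWord w) m = ∏ k, v (w k) := by
  rw [wordProd, Finset.prod_range]
  simp [extendWord_apply]

end Words

/-! ### The coding map -/

section Coding

variable {d N : ℕ} {f : Fin N → RSpace d → RSpace d} {lam : Fin N → ℝ}

theorem dist_wordMap (hf : ∀ i, IsSimilarity (f i) (lam i)) (ω : SymbolSpace N) (n : ℕ)
    (x y : RSpace d) :
    dist (wordMap f ω n x) (wordMap f ω n y) = wordProd lam ω n * dist x y := by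
  induction n generalizing x y with
  | zero => simp [wordMap, wordProd_zero]
  | succ n ih =>
    rw [wordProd_succ, mul_assoc, ← hf, ← ih]; rfl

theorem wordMap_injective (h0 : ∀ i, 0 < lam i) (hf : ∀ i, IsSimilarity (f i) (lam i))
    (ω : SymbolSpace N) (n : ℕ) : Function.Injective (wordMap f ω n) := fun x y h => by
  have := dist_wordMap hf ω n x y
  rw [h, dist_self] at this
  exact dist_eq_zero.1 ((mul_eq_zero.1 this.symm).resolve_left (wordProd_pos h0 ω n).ne')

theorem continuous_wordMap (hf : ∀ i, IsSimilarity (f i) (lam i)) (ω : SymbolSpace N) (n : ℕ) :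
    Continuous (wordMap f ω n) :=
  LipschitzWith.continuous (K := (wordProd lam ω n).toNNReal) <|
    LipschitzWith.of_dist_le_mul fun x y => by
      rw [dist_wordMap hf]
      exact mul_le_mul_of_nonneg_right (Real.le_coe_toNNReal _) dist_nonneg

theorem wordMap_congr {ω η : SymbolSpace N} {n : ℕ} (h : ω ∈ PiNat.cylinder η n) :
    wordMap f ω n = wordMap f η n := by
  induction n with
  | zero => rfl
  | succ n ih =>
    rw [wordMap, wordMap, ih (PiNat.cylinder_anti _ n.le_succ h), h n n.lt_succ_self]

theorem wordMap_splice_add (ω η : SymbolSpace N) (n m : ℕ) :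
    wordMap f (splice ω n η) (n + m) = wordMap f ω n ∘ wordMap f η m := by
  induction m with
  | zero => simpa [wordMap] using wordMap_congr splice_mem_cylinder
  | succ m ih => rw [← add_assoc, wordMap, wordMap, ih, splice_apply_add]; rfl

theorem wordMap_add (ω : SymbolSpace N) (n m : ℕ) :
    wordMap f ω (n + m) = wordMap f ω n ∘ wordMap f (shift^[n] ω) m := by
  conv_lhs => rw [← splice_shift_iterate (ω := ω) (n := n)]
  exact wordMap_splice_add _ _ _ _

theorem codingMap_eq_wordMap (h1 : ∀ i, lam i < 1) (hf : ∀ i, IsSimilarity (f i) (lam i))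
    (ω : SymbolSpace N) (n : ℕ) :
    codingMap f ω = wordMap f ω n (codingMap f (shift^[n] ω)) := by
  refine tendsto_nhds_unique ((tendsto_add_atTop_iff_nat n).2 (tendsto_codingMap h1 hf ω)) ?_
  have := ((continuous_wordMap hf ω n).tendsto _).comp (tendsto_codingMap h1 hf (shift^[n] ω))
  refine this.congr fun m => ?_
  rw [add_comm, wordMap_add]; rfl

theorem codingMap_splice (h1 : ∀ i, lam i < 1) (hf : ∀ i, IsSimilarity (f i) (lam i))
    (ω η : SymbolSpace N) (n : ℕ) :
    codingMap f (splice ω n η) = wordMap f ω n (codingMap f η) := by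
  rw [codingMap_eq_wordMap h1 hf _ n, shift_iterate_splice, wordMap_congr splice_mem_cylinder]

theorem range_codingMap (h0 : ∀ i, 0 < lam i) (h1 : ∀ i, lam i < 1)
    (hf : ∀ i, IsSimilarity (f i) (lam i)) {L : Set (RSpace d)} (hL : IsAttractor f L) :
    Set.range (codingMap f) = L := by
  obtain ⟨⟨z, hz⟩, hc, hLu⟩ := hL
  have hmaps : ∀ i, ∀ x ∈ L, f i x ∈ L := fun i x hx => by
    rw [hLu]; exact Set.mem_iUnion.2 ⟨i, x, hx, rfl⟩
  apply Set.Subset.antisymm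
  · rintro _ ⟨ω, rfl⟩
    have hmem : ∀ n, ∀ x ∈ L, wordMap f ω n x ∈ L := fun n => by
      induction n with
      | zero => exact fun x hx => hx
      | succ n ih => exact fun x hx => ih _ (hmaps _ _ hx)
    have hdist : Tendsto (fun n => dist (wordMap f ω n 0) (wordMap f ω n z)) atTop (𝓝 0) := by
      simp only [dist_wordMap hf]
      simpa using (tendsto_wordProd_zero h0 h1 ω).mul_const (dist 0 z)
    exact hc.isClosed.mem_of_tendsto
      (((tendsto_iff_of_dist hdist).1 (tendsto_codingMap h1 hf ω)))
      (Eventually.of_forall fun n => hmem n z hz)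
  · intro x hx
    -- Every point of `L` has a preimage in `L` under some map. Iterating a choice of preimages
    -- produces the letters of a coding, and compactness of `L` keeps the preimages bounded.
    have hpre : ∀ y : L, ∃ i, ∃ y' : L, f i y' = y := fun ⟨y, hy⟩ => by
      rw [hLu] at hy
      obtain ⟨i, y', hy', rfl⟩ := Set.mem_iUnion.1 hy
      exact ⟨i, ⟨y', hy'⟩, rfl⟩
    choose i g hg using hpre
    let y : ℕ → L := fun n => g^[n] ⟨x, hx⟩
    have hy : ∀ n, f (i (y n)) (y (n + 1)) = y n := fun n => by
      simp only [y, Function.iterate_succ_apply']; exact hg _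
    let ω : SymbolSpace N := fun n => i (y n)
    have hw : ∀ n, wordMap f ω n (y n) = x := fun n => by
      induction n with
      | zero => rfl
      | succ n ih => rw [wordMap, Function.comp_apply, show f (ω n) (y (n + 1)) = y n from hy n, ih]
    obtain ⟨C, hC⟩ := Metric.isBounded_iff_subset_closedBall (0 : RSpace d) |>.1 hc.isBounded
    have hdist : Tendsto (fun n => dist (wordMap f ω n 0) (wordMap f ω n (y n))) atTop (𝓝 0) := by
      simp only [dist_wordMap hf]
      refine squeeze_zero (fun n => mul_nonneg (wordProd_pos h0 ω n).le dist_nonneg) (fun n => ?_)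
        (by simpa using (tendsto_wordProd_zero h0 h1 ω).mul_const C)
      refine mul_le_mul_of_nonneg_left ?_ (wordProd_pos h0 ω n).le
      rw [dist_comm]; exact hC (y n).2
    refine ⟨ω, tendsto_nhds_unique (tendsto_codingMap h1 hf ω) ((tendsto_iff_of_dist hdist).2 ?_)⟩
    simp only [hw]; exact tendsto_const_nhds

theorem isCompact_range_codingMap (h0 : ∀ i, 0 < lam i) (h1 : ∀ i, lam i < 1)
    (hf : ∀ i, IsSimilarity (f i) (lam i)) {L : Set (RSpace d)} (hL : IsAttractor f L) :
    IsCompact (Set.range (codingMap f)) := range_codingMap h0 h1 hf hL ▸ hL.2.1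

theorem dist_codingMap_le (h0 : ∀ i, 0 < lam i) (h1 : ∀ i, lam i < 1)
    (hf : ∀ i, IsSimilarity (f i) (lam i)) (hb : Bornology.IsBounded (Set.range (codingMap f)))
    {ω η : SymbolSpace N} {n : ℕ} (h : η ∈ PiNat.cylinder ω n) :
    dist (codingMap f η) (codingMap f ω)
      ≤ wordProd lam ω n * Metric.diam (Set.range (codingMap f)) := by
  rw [codingMap_eq_wordMap h1 hf ω n, codingMap_eq_wordMap h1 hf η n, wordMap_congr h,
    dist_wordMap hf]
  exact mul_le_mul_of_nonneg_left (Metric.dist_le_diam_of_mem hb ⟨_, rfl⟩ ⟨_, rfl⟩)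
    (wordProd_pos h0 ω n).le

theorem ediam_image_cylinder_le (h0 : ∀ i, 0 < lam i) (h1 : ∀ i, lam i < 1)
    (hf : ∀ i, IsSimilarity (f i) (lam i)) (hb : Bornology.IsBounded (Set.range (codingMap f)))
    (ω : SymbolSpace N) (n : ℕ) :
    Metric.ediam (codingMap f '' PiNat.cylinder ω n)
      ≤ ENNReal.ofReal (wordProd lam ω n * Metric.diam (Set.range (codingMap f))) := by
  refine Metric.ediam_le ?_
  rintro _ ⟨η, hη, rfl⟩ _ ⟨η', hη', rfl⟩
  rw [edist_dist]
  refine ENNReal.ofReal_le_ofReal ?_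
  rw [← wordProd_congr hη']
  exact dist_codingMap_le h0 h1 hf hb (by
    rw [PiNat.mem_cylinder_iff_eq] at hη hη'; rw [hη', ← hη]; exact PiNat.self_mem_cylinder _ _)

theorem continuous_codingMap (h0 : ∀ i, 0 < lam i) (h1 : ∀ i, lam i < 1)
    (hf : ∀ i, IsSimilarity (f i) (lam i)) (hb : Bornology.IsBounded (Set.range (codingMap f))) :
    Continuous (codingMap f) := by
  rw [continuous_iff_continuousAt]
  intro ω
  rw [ContinuousAt, Metric.tendsto_nhds]
  intro ε hε
  have ht : Tendsto (fun n => wordProd lam ω n * Metric.diam (Set.range (codingMap f))) atTop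
      (𝓝 0) := by
    simpa using (tendsto_wordProd_zero h0 h1 ω).mul_const _
  obtain ⟨n, hn⟩ := (ht.eventually (gt_mem_nhds hε)).exists
  filter_upwards [(PiNat.isOpen_cylinder _ ω n).mem_nhds (PiNat.self_mem_cylinder ω n)] with η hη
  exact (dist_codingMap_le h0 h1 hf hb hη).trans_lt hn

end Coding

/-! ### Bernoulli measures -/

section Bernoulli

variable {N : ℕ} {p : Fin N → ℝ}

theorem letterMeasure_singleton (p : Fin N → ℝ) (i : Fin N) :
    letterMeasure p {i} = ENNReal.ofReal (p i) := by
  simp only [letterMeasure, Measure.coe_finsetSum, Finset.sum_apply, Measure.smul_apply,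
    smul_eq_mul]
  rw [Finset.sum_eq_single i]
  · simp
  · intro j _ hj; simp [hj]
  · simp

theorem isProbabilityMeasure_bernoulliMeasure (hp : ∀ i, 0 < p i) (hp1 : ∑ i, p i = 1) :
    IsProbabilityMeasure (bernoulliMeasure p) := by
  have := isProbabilityMeasure_letterMeasure hp hp1
  unfold bernoulliMeasure; infer_instance

theorem measurable_shift_iterate (n : ℕ) : Measurable (shift^[n] : SymbolSpace N → SymbolSpace N) :=
  measurable_pi_lambda _ fun k => by
    simp only [shift_iterate_apply]; exact measurable_pi_apply _

theorem measurableSet_cylinder (ω : SymbolSpace N) (n : ℕ) : MeasurableSet (PiNat.cylinder ω n) :=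
  (PiNat.isOpen_cylinder _ ω n).measurableSet

theorem bernoulliMeasure_cylinder (hp : ∀ i, 0 < p i) (hp1 : ∑ i, p i = 1) (ω : SymbolSpace N)
    (n : ℕ) : bernoulliMeasure p (PiNat.cylinder ω n) = ENNReal.ofReal (wordProd p ω n) := by
  have := isProbabilityMeasure_letterMeasure hp hp1
  rw [PiNat.cylinder_eq_pi, bernoulliMeasure, Measure.infinitePi_pi _ (by simp), wordProd,
    ENNReal.ofReal_prod_of_nonneg fun i _ => (hp _).le]
  simp [letterMeasure_singleton]

/-- Independence of the first `n` letters from the rest. The shifted measure conditioned on the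
cylinder has the right values on finite boxes, which characterise the product measure. -/
theorem bernoulliMeasure_cylinder_inter (hp : ∀ i, 0 < p i) (hp1 : ∑ i, p i = 1)
    (ω : SymbolSpace N) (n : ℕ) {A : Set (SymbolSpace N)} (hA : MeasurableSet A) :
    bernoulliMeasure p (PiNat.cylinder ω n ∩ shift^[n] ⁻¹' A)
      = bernoulliMeasure p (PiNat.cylinder ω n) * bernoulliMeasure p A := by
  have := isProbabilityMeasure_letterMeasure hp hp1
  have := isProbabilityMeasure_bernoulliMeasure hp hp1
  set μ := bernoulliMeasure p with hμ
  set c := μ (PiNat.cylinder ω n) with hc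
  have hc0 : c ≠ 0 := by
    rw [hc, bernoulliMeasure_cylinder hp hp1, Ne, ENNReal.ofReal_eq_zero, not_le]
    exact wordProd_pos hp ω n
  have hct : c ≠ ∞ := measure_ne_top _ _
  have key : c⁻¹ • Measure.map (shift^[n]) (μ.restrict (PiNat.cylinder ω n)) = μ := by
    refine Measure.eq_infinitePi _ fun s t ht => ?_
    have hpi : MeasurableSet (Set.pi (s : Set ℕ) t) := .pi s.countable_toSet fun i _ => ht i
    rw [Measure.smul_apply, Measure.map_apply (measurable_shift_iterate n) hpi,
      Measure.restrict_apply (measurable_shift_iterate n hpi), smul_eq_mul]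
    -- The constraints sit on disjoint coordinates: the first `n`, and the translate of `s` by `n`.
    have hset : shift^[n] ⁻¹' (Set.pi (s : Set ℕ) t) ∩ PiNat.cylinder ω n
        = Set.pi ((Finset.range n).disjUnion (s.map (addLeftEmbedding n)) (by
            rw [Finset.disjoint_left]; simp; omega) : Finset ℕ)
            (fun k => if k < n then {ω k} else t (k - n)) := by
      ext η
      simp only [Set.mem_inter_iff, Set.mem_preimage, Set.mem_pi, shift_iterate_apply,
        PiNat.mem_cylinder_iff, Finset.mem_coe, Finset.mem_disjUnion, Finset.mem_range,
        Finset.mem_map, addLeftEmbedding_apply]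
      constructor
      · rintro ⟨h1, h2⟩ k (hk | ⟨a, ha, rfl⟩)
        · simpa [hk] using h2 k hk
        · simpa using h1 a ha
      · intro h
        refine ⟨fun a ha => by simpa using h (n + a) (Or.inr ⟨a, ha, rfl⟩), fun k hk => ?_⟩
        simpa [hk] using h k (Or.inl hk)
    rw [hset, hμ, bernoulliMeasure, Measure.infinitePi_pi _ (by
      intro i _; split_ifs
      · exact measurableSet_singleton _
      · exact ht _), Finset.prod_disjUnion, Finset.prod_map]
    have h1 : ∏ x ∈ Finset.range n, letterMeasure p (if x < n then {ω x} else t (x - n)) = c := by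
      rw [hc, hμ, PiNat.cylinder_eq_pi, bernoulliMeasure, Measure.infinitePi_pi _ (by simp)]
      exact Finset.prod_congr rfl fun x hx => by simp [Finset.mem_range.1 hx]
    rw [h1, ← mul_assoc, ENNReal.inv_mul_cancel hc0 hct, one_mul]
    simp
  have h := congrArg (fun ν : Measure (SymbolSpace N) => ν A) key
  simp only [Measure.smul_apply, smul_eq_mul] at h
  rw [Measure.map_apply (measurable_shift_iterate n) hA,
      Measure.restrict_apply (measurable_shift_iterate n hA)] at h
  rw [← h, ← mul_assoc, ENNReal.mul_inv_cancel hc0 hct, one_mul, Set.inter_comm]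

theorem measurePreserving_shift_iterate (hp : ∀ i, 0 < p i) (hp1 : ∑ i, p i = 1) (n : ℕ) :
    MeasurePreserving (shift^[n]) (bernoulliMeasure p) (bernoulliMeasure p) := by
  have := isProbabilityMeasure_letterMeasure hp hp1
  refine ⟨measurable_shift_iterate n, Measure.eq_infinitePi _ fun s t ht => ?_⟩
  have hpi : MeasurableSet (Set.pi (s : Set ℕ) t) := .pi s.countable_toSet fun i _ => ht i
  rw [Measure.map_apply (measurable_shift_iterate n) hpi]
  have hset : shift^[n] ⁻¹' (Set.pi (s : Set ℕ) t)
      = Set.pi (s.map (addLeftEmbedding n) : Finset ℕ) (fun k => t (k - n)) := by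
    ext η
    simp [shift_iterate_apply]
  rw [hset, bernoulliMeasure, Measure.infinitePi_pi _ fun i _ => ht _, Finset.prod_map]
  simp

theorem tendsto_average_letters (hp : ∀ i, 0 < p i) (hp1 : ∑ i, p i = 1) (φ : Fin N → ℝ) :
    ∀ᵐ ω ∂(bernoulliMeasure p),
      Tendsto (fun n : ℕ => (∑ k ∈ Finset.range n, φ (ω k)) / n) atTop (𝓝 (∑ i, p i * φ i)) := by
  have := isProbabilityMeasure_letterMeasure hp hp1
  have := isProbabilityMeasure_bernoulliMeasure hp hp1
  have hφ : Measurable φ := measurable_of_finite φ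
  have hev : ∀ k, MeasurePreserving (fun ω : SymbolSpace N => ω k) (bernoulliMeasure p)
      (letterMeasure p) := fun k => measurePreserving_eval_infinitePi (fun _ => letterMeasure p) k
  have hm : ∀ k, Measurable fun ω : SymbolSpace N => φ (ω k) := fun k =>
    hφ.comp (measurable_pi_apply k)
  have hint : Integrable φ (letterMeasure p) := Integrable.of_finite
  have hind : ProbabilityTheory.iIndepFun (fun k (ω : SymbolSpace N) => φ (ω k))
      (bernoulliMeasure p) :=
    ProbabilityTheory.iIndepFun_infinitePi (P := fun _ : ℕ => letterMeasure p)
      (X := fun _ => φ) fun _ => hφ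
  have hexp : ∫ ω, φ (ω 0) ∂(bernoulliMeasure p) = ∑ i, p i * φ i := by
    rw [← integral_map (φ := fun ω : SymbolSpace N => ω 0) (f := φ) (hev 0).measurable.aemeasurable
      hφ.aestronglyMeasurable, (hev 0).map_eq, integral_fintype hint]
    simp [Measure.real, letterMeasure_singleton, ENNReal.toReal_ofReal (hp _).le]
  have h := ProbabilityTheory.strong_law_ae_real (μ := bernoulliMeasure p)
    (fun k (ω : SymbolSpace N) => φ (ω k)) ((hev 0).integrable_comp_of_integrable hint)
    (fun i j hij => hind.indepFun hij)
    (fun i => ⟨(hm i).aemeasurable, (hm 0).aemeasurable, by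
      rw [← Function.comp_def φ, ← Measure.map_map hφ (hev i).measurable, (hev i).map_eq,
        ← (hev 0).map_eq, Measure.map_map hφ (hev 0).measurable]; rfl⟩)
  rwa [hexp] at h

/-- If the average of `φ` is less than `c`, then almost surely the sums of `φ` along the letters
are eventually at most `c n`. -/
theorem eventually_sum_letters_le (hp : ∀ i, 0 < p i) (hp1 : ∑ i, p i = 1) (φ : Fin N → ℝ) {c : ℝ}
    (hc : ∑ i, p i * φ i < c) :
    ∀ᵐ ω ∂(bernoulliMeasure p), ∀ᶠ n : ℕ in atTop, ∑ k ∈ Finset.range n, φ (ω k) ≤ c * n := by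
  filter_upwards [tendsto_average_letters hp hp1 φ] with ω hω
  filter_upwards [hω.eventually (gt_mem_nhds hc), eventually_gt_atTop 0] with n hn hn0
  rw [div_lt_iff₀ (by exact_mod_cast hn0)] at hn
  exact hn.le

end Bernoulli

/-! ### Hitting times of cylinders under the shift -/

section Hitting

variable {N : ℕ} {p : Fin N → ℝ}

theorem measurableSet_avoid (ω : SymbolSpace N) (m J : ℕ) :
    MeasurableSet {o : SymbolSpace N | ∀ j < J, shift^[j * m] o ∉ PiNat.cylinder ω m} := by
  simp only [Set.ofPred_forall]
  exact .iInter fun j => .iInter fun _ =>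
    (measurable_shift_iterate _ (measurableSet_cylinder ω m)).compl

/-- The blocks starting at multiples of `m` do not overlap, so the trials are independent and the
probability is at most `(1 - p(w))^J`. Only these times are tested; this costs a factor `m` in time,
which is harmless at exponential scale. -/
theorem bernoulliMeasure_avoid_le (hp : ∀ i, 0 < p i) (hp1 : ∑ i, p i = 1) (ω : SymbolSpace N)
    (m J : ℕ) :
    (bernoulliMeasure p).real {o | ∀ j < J, shift^[j * m] o ∉ PiNat.cylinder ω m}
      ≤ Real.exp (-(J * wordProd p ω m)) := by
  have := isProbabilityMeasure_bernoulliMeasure hp hp1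
  induction J with
  | zero => simp
  | succ J ih =>
    set E := {o : SymbolSpace N | ∀ j < J, shift^[j * m] o ∉ PiNat.cylinder ω m} with hE
    have hEm : MeasurableSet E := measurableSet_avoid ω m J
    have hset : {o : SymbolSpace N | ∀ j < J + 1, shift^[j * m] o ∉ PiNat.cylinder ω m}
        = shift^[m] ⁻¹' E \ PiNat.cylinder ω m := by
      ext o
      simp only [hE, Set.mem_ofPred_eq, Set.mem_sdiff, Set.mem_preimage]
      constructor
      · refine fun h => ⟨fun j hj => ?_, by simpa using h 0 (by omega)⟩
        rw [← Function.iterate_add_apply]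
        simpa [add_mul] using h (j + 1) (by omega)
      · rintro ⟨h1, h2⟩ (_ | j) hj
        · simpa using h2
        · have := h1 j (by omega)
          rw [← Function.iterate_add_apply] at this
          simpa [add_mul] using this
    have h1 : (bernoulliMeasure p).real (shift^[m] ⁻¹' E) = (bernoulliMeasure p).real E :=
      congrArg ENNReal.toReal ((measurePreserving_shift_iterate hp hp1 m).measure_preimage
        hEm.nullMeasurableSet)
    have h2 : (bernoulliMeasure p).real (shift^[m] ⁻¹' E ∩ PiNat.cylinder ω m)
        = wordProd p ω m * (bernoulliMeasure p).real E := by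
      rw [Set.inter_comm, Measure.real, bernoulliMeasure_cylinder_inter hp hp1 ω m hEm,
        ENNReal.toReal_mul, bernoulliMeasure_cylinder hp hp1,
        ENNReal.toReal_ofReal (wordProd_pos hp ω m).le]; rfl
    have h3 := measureReal_inter_add_sdiff (μ := bernoulliMeasure p) (s := shift^[m] ⁻¹' E)
      (measurableSet_cylinder ω m)
    rw [hset]
    calc (bernoulliMeasure p).real (shift^[m] ⁻¹' E \ PiNat.cylinder ω m)
        = (1 - wordProd p ω m) * (bernoulliMeasure p).real E := by rw [h1, h2] at h3; linarith
      _ ≤ Real.exp (-wordProd p ω m) * Real.exp (-(J * wordProd p ω m)) := by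
          refine mul_le_mul ?_ ih measureReal_nonneg (Real.exp_pos _).le
          linarith [Real.add_one_le_exp (-wordProd p ω m)]
      _ = Real.exp (-((J + 1 : ℕ) * wordProd p ω m)) := by
          rw [← Real.exp_add]; push_cast; congr 1; ring

/-- This is the union bound: number of words times the probability that one is missed in
`⌊e^{bm}/m⌋` trials. The inner exponent grows like `e^{(b-a)m}/m`, which beats `m log M + m`. -/
theorem eventually_pow_mul_exp_le {a b : ℝ} (ha : 0 ≤ a) (hab : a < b) (M : ℕ) (hM : 0 < M) :
    ∀ᶠ m : ℕ in atTop, (M : ℝ) ^ m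
      * Real.exp (-(⌊Real.exp (b * m) / m⌋₊ * Real.exp (-(a * m)))) ≤ Real.exp (-(m : ℝ)) := by
  have hM' : (0 : ℝ) < M := by exact_mod_cast hM
  -- The power `2` pays for the division by `m` and for the factor `m` of the target. Of the `+ 2`
  -- in the threshold below, one unit absorbs the rounding of the floor.
  have h := (tendsto_exp_mul_div_rpow_atTop 2 (b - a) (by linarith)).comp
    tendsto_natCast_atTop_atTop
  filter_upwards [h.eventually_ge_atTop (Real.log M + 2), eventually_ge_atTop 1] with m hm hm1
  have hm1' : (1 : ℝ) ≤ m := by exact_mod_cast hm1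
  have hm0 : (0 : ℝ) < m := by linarith
  simp only [Function.comp_apply, Real.rpow_two] at hm
  rw [le_div_iff₀ (by positivity)] at hm
  have hJ : Real.exp (b * m) / m - 1 ≤ ⌊Real.exp (b * m) / m⌋₊ := (Nat.sub_one_lt_floor _).le
  have hea : Real.exp (-(a * m)) ≤ 1 := Real.exp_le_one_iff.2 (by nlinarith)
  have hJ2 : m * (Real.log M + 1) ≤ ⌊Real.exp (b * m) / m⌋₊ * Real.exp (-(a * m)) := by
    calc (m : ℝ) * (Real.log M + 1) ≤ m * (Real.log M + 2) - 1 := by linarith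
      _ ≤ Real.exp ((b - a) * m) / m - 1 := by
          gcongr
          rw [le_div_iff₀ hm0]; nlinarith
      _ ≤ Real.exp ((b - a) * m) / m - Real.exp (-(a * m)) := by linarith
      _ = (Real.exp (b * m) / m - 1) * Real.exp (-(a * m)) := by
          have : Real.exp ((b - a) * m) = Real.exp (b * m) * Real.exp (-(a * m)) := by
            rw [← Real.exp_add]; ring_nf
          rw [this]; ring
      _ ≤ _ := by gcongr
  calc (M : ℝ) ^ m * Real.exp (-(⌊Real.exp (b * m) / m⌋₊ * Real.exp (-(a * m))))
      = Real.exp (m * Real.log M + -(⌊Real.exp (b * m) / m⌋₊ * Real.exp (-(a * m)))) := by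
        rw [Real.exp_add, Real.exp_nat_mul, Real.exp_log hM']
    _ ≤ Real.exp (-(m : ℝ)) := Real.exp_le_exp.2 (by linarith)

/-- Almost surely, for all large `m`, all words of length `m` and probability at least `e^{-am}`
occur at some time between `m` and `e^{bm}`, provided `a < b`. -/
theorem ae_eventually_forall_exists_hit [NeZero N] (hp : ∀ i, 0 < p i) (hp1 : ∑ i, p i = 1)
    {a b : ℝ} (ha : 0 ≤ a) (hab : a < b) :
    ∀ᵐ o ∂(bernoulliMeasure p), ∀ᶠ m : ℕ in atTop, ∀ ω : SymbolSpace N,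
      Real.exp (-(a * m)) ≤ wordProd p ω m →
        ∃ n : ℕ, m ≤ n ∧ (n : ℝ) ≤ Real.exp (b * m) ∧ shift^[n] o ∈ PiNat.cylinder ω m := by
  have := isProbabilityMeasure_bernoulliMeasure hp hp1
  let J : ℕ → ℕ := fun m => ⌊Real.exp (b * m) / m⌋₊
  let avoid : (m : ℕ) → (Fin m → Fin N) → Set (SymbolSpace N) := fun m w =>
    {o | ∀ j < J m, shift^[j * m] o ∉ PiNat.cylinder (extendWord w) m}
  -- Testing only after time `m` makes the hitting time at least `m`, so that later these times tend
  -- to infinity.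
  let bad : ℕ → Set (SymbolSpace N) := fun m =>
    ⋃ w ∈ {w : Fin m → Fin N | Real.exp (-(a * m)) ≤ wordProd p (extendWord w) m},
      shift^[m] ⁻¹' avoid m w
  have hbad : ∀ m, (bernoulliMeasure p).real (bad m)
      ≤ (N : ℝ) ^ m * Real.exp (-(J m * Real.exp (-(a * m)))) := fun m => by
    classical
    have hle : bad m = ⋃ w ∈ (Finset.univ.filter fun w : Fin m → Fin N =>
      Real.exp (-(a * m)) ≤ wordProd p (extendWord w) m), shift^[m] ⁻¹' avoid m w := by
        simp [bad]
    rw [hle]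
    refine (measureReal_biUnion_finset_le _ _).trans ?_
    have hcard : ((Finset.univ.filter fun w : Fin m → Fin N =>
      Real.exp (-(a * m)) ≤ wordProd p (extendWord w) m).card : ℝ) ≤ (N : ℝ) ^ m := by
        have := Finset.card_filter_le (Finset.univ : Finset (Fin m → Fin N))
          fun w => Real.exp (-(a * m)) ≤ wordProd p (extendWord w) m
        simp only [Finset.card_univ, Fintype.card_fun, Fintype.card_fin] at this
        exact_mod_cast this
    refine (Finset.sum_le_card_nsmul _ _ (Real.exp (-(J m * Real.exp (-(a * m)))))
      fun w hw => ?_).trans ?_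
    · have h1 : (bernoulliMeasure p).real (shift^[m] ⁻¹' avoid m w)
          = (bernoulliMeasure p).real (avoid m w) :=
        congrArg ENNReal.toReal ((measurePreserving_shift_iterate hp hp1 m).measure_preimage
          (measurableSet_avoid _ _ _).nullMeasurableSet)
      rw [h1]
      refine (bernoulliMeasure_avoid_le hp hp1 _ _ _).trans (Real.exp_le_exp.2 ?_)
      have := (Finset.mem_filter.1 hw).2
      gcongr
    · rw [nsmul_eq_mul]
      gcongr
  have hsum : Summable fun m => (bernoulliMeasure p).real (bad m) := by
    refine Summable.of_norm_bounded_eventually_nat (g := fun m : ℕ => Real.exp (-(m : ℝ)))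
      Real.summable_exp_neg_nat ?_
    filter_upwards [eventually_pow_mul_exp_le ha hab N (Nat.pos_of_neZero N)] with m hm
    rw [Real.norm_of_nonneg measureReal_nonneg]
    exact (hbad m).trans hm
  have htsum : ∑' m, bernoulliMeasure p (bad m) ≠ ∞ := by
    simpa only [ofReal_measureReal (measure_ne_top _ _)] using hsum.tsum_ofReal_ne_top
  filter_upwards [ae_eventually_notMem htsum] with o ho
  filter_upwards [ho, eventually_ge_atTop 1] with m hm hm1 ω hω
  have hcyl : extendWord (fun k : Fin m => ω k) ∈ PiNat.cylinder ω m :=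
    extendWord_restrict_mem_cylinder ω m
  simp only [bad, avoid, Set.mem_iUnion, not_exists, Set.mem_ofPred_eq, Set.mem_preimage] at hm
  have := hm (fun k : Fin m => ω k) (by rwa [wordProd_congr hcyl])
  push Not at this
  obtain ⟨j, hj, hjm⟩ := this
  rw [← Function.iterate_add_apply] at hjm
  refine ⟨j * m + m, by omega, ?_, ?_⟩
  · have hm0 : (0 : ℝ) < m := by exact_mod_cast hm1
    have h1 : ((j + 1 : ℕ) : ℝ) ≤ Real.exp (b * m) / m :=
      (Nat.le_floor_iff (by positivity)).1 (Nat.succ_le_of_lt hj)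
    rw [le_div_iff₀ hm0] at h1
    push_cast at h1 ⊢
    linarith
  · rwa [(PiNat.mem_cylinder_iff_eq.1 hcyl)] at hjm

/-- Almost every sequence contains every word infinitely often. -/
theorem ae_forall_frequently_shift_mem_cylinder [NeZero N] (hp : ∀ i, 0 < p i)
    (hp1 : ∑ i, p i = 1) :
    ∀ᵐ o ∂(bernoulliMeasure p), ∀ (ω : SymbolSpace N) (k : ℕ),
      ∃ᶠ n in atTop, shift^[n] o ∈ PiNat.cylinder ω k := by
  obtain ⟨c, hc0, hc⟩ := exists_pos_forall_le hp
  have hc1 : c ≤ 1 := by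
    rw [← hp1]
    exact (hc 0).trans (Finset.single_le_sum (fun i _ => (hp i).le) (Finset.mem_univ 0))
  -- With `a = -log c` the probability threshold is `c^m`, which every word of length `m` meets.
  have ha : 0 ≤ -Real.log c := by linarith [Real.log_nonpos hc0.le hc1]
  filter_upwards [ae_eventually_forall_exists_hit hp hp1 ha (lt_add_one _)] with o ho ω k
  rw [frequently_atTop]
  intro M
  obtain ⟨m, hm, hmk⟩ := (ho.and (eventually_ge_atTop (max k M))).exists
  obtain ⟨n, hn, -, hn2⟩ := hm ω (by
    rw [neg_mul, neg_neg, Real.exp_mul, Real.exp_log hc0, Real.rpow_natCast, ← wordProd_const c ω m]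
    exact wordProd_mono (fun _ => hc0.le) hc ω m)
  exact ⟨n, (le_max_right _ _).trans (hmk.trans hn), PiNat.cylinder_anti _
    ((le_max_left _ _).trans hmk) hn2⟩

/-- A sequence whose cylinders have small probability is almost surely covered only finitely
often. -/
theorem ae_not_frequently_mem_cylinder_shift (hp : ∀ i, 0 < p i) (hp1 : ∑ i, p i = 1)
    {l : ℕ → ℕ} {a c : ℝ} (ha : 0 < a) (hac : 1 < a * c)
    (hl : ∀ᶠ n : ℕ in atTop, c * Real.log n ≤ l n) {ω : SymbolSpace N}
    (hω : ∀ᶠ k : ℕ in atTop, wordProd p ω k ≤ Real.exp (-(a * k))) :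
    ∀ᵐ o ∂(bernoulliMeasure p), ¬ ∃ᶠ n in atTop, ω ∈ PiNat.cylinder (shift^[n] o) (l n) := by
  have := isProbabilityMeasure_bernoulliMeasure hp hp1
  have hc : 0 < c := by by_contra! h; nlinarith
  have hltop : Tendsto l atTop atTop := by
    rw [← tendsto_natCast_atTop_iff (R := ℝ)]
    exact tendsto_atTop_mono' _ hl
      ((Real.tendsto_log_atTop.comp tendsto_natCast_atTop_atTop).const_mul_atTop hc)
  let hit : ℕ → Set (SymbolSpace N) := fun n => {o | ω ∈ PiNat.cylinder (shift^[n] o) (l n)}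
  have hhit : ∀ n, bernoulliMeasure p (hit n) = ENNReal.ofReal (wordProd p ω (l n)) := fun n => by
    have : hit n = shift^[n] ⁻¹' PiNat.cylinder ω (l n) := by
      ext o; exact PiNat.mem_cylinder_comm _ _ _
    rw [this, (measurePreserving_shift_iterate hp hp1 n).measure_preimage
      (measurableSet_cylinder _ _).nullMeasurableSet, bernoulliMeasure_cylinder hp hp1]
  -- Here `p(ω|l(n)) ≤ e^{-a l(n)} ≤ n^{-ac}` for large `n`, with exponent `ac > 1`.
  have hsum : Summable fun n => wordProd p ω (l n) := by
    refine Summable.of_norm_bounded_eventually_nat (g := fun n : ℕ => ((n : ℝ) ^ (a * c))⁻¹)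
      (Real.summable_nat_rpow_inv.2 hac) ?_
    filter_upwards [hl, hltop.eventually hω, eventually_gt_atTop 0] with n h1 h2 h3
    rw [Real.norm_of_nonneg (wordProd_pos hp _ _).le]
    refine h2.trans ?_
    rw [← Real.rpow_neg (by positivity), Real.rpow_def_of_pos (by exact_mod_cast h3)]
    exact Real.exp_le_exp.2 (by nlinarith)
  have htsum : ∑' n, bernoulliMeasure p (hit n) ≠ ∞ := by
    simpa only [hhit] using hsum.tsum_ofReal_ne_top
  filter_upwards [ae_eventually_notMem htsum] with o ho
  rw [not_frequently]
  exact ho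

theorem measurableSet_frequently_mem_cylinder_shift (l : ℕ → ℕ) :
    MeasurableSet {x : SymbolSpace N × SymbolSpace N |
      ∃ᶠ n in atTop, x.1 ∈ PiNat.cylinder (shift^[n] x.2) (l n)} := by
  simp only [frequently_atTop, Set.ofPred_forall, Set.ofPred_exists, PiNat.mem_cylinder_iff,
    shift_iterate_apply, Set.ofPred_and]
  refine .iInter fun _ => .iUnion fun n => .inter (.const _) <| .iInter fun i => .iInter fun _ =>
    measurableSet_eq_fun ?_ ?_
  · exact (measurable_pi_apply i).comp measurable_fst
  · exact (measurable_pi_apply (n + i)).comp measurable_snd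

/-- If almost every sequence for the weights `m` has cylinders of small `p`-probability, then for
almost every `o`, almost every sequence is covered only finitely often. -/
theorem ae_ae_not_frequently_mem_cylinder_shift (hp : ∀ i, 0 < p i) (hp1 : ∑ i, p i = 1)
    {m : Fin N → ℝ} (hm : ∀ i, 0 < m i) (hm1 : ∑ i, m i = 1)
    {l : ℕ → ℕ} {a c : ℝ} (ha : 0 < a) (hac : 1 < a * c)
    (hl : ∀ᶠ n : ℕ in atTop, c * Real.log n ≤ l n)
    (hmp : a < -∑ i, m i * Real.log (p i)) :
    ∀ᵐ o ∂(bernoulliMeasure p), ∀ᵐ ω ∂(bernoulliMeasure m),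
      ¬ ∃ᶠ n in atTop, ω ∈ PiNat.cylinder (shift^[n] o) (l n) := by
  have := isProbabilityMeasure_bernoulliMeasure hp hp1
  have := isProbabilityMeasure_bernoulliMeasure hm hm1
  -- After exchanging the quantifiers by Fubini, `ω` is fixed and Borel-Cantelli applies in `o`.
  rw [← Measure.ae_ae_comm (measurableSet_frequently_mem_cylinder_shift l).compl]
  filter_upwards [eventually_sum_letters_le hm hm1 (fun i => Real.log (p i)) (c := -a)
    (by linarith)] with ω hω
  refine ae_not_frequently_mem_cylinder_shift hp hp1 ha hac hl ?_
  filter_upwards [hω] with k hk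
  rw [← Real.log_le_iff_le_exp (wordProd_pos hp ω k), log_wordProd hp]
  linarith

end Hitting

/-! ### Stopping words at a given scale -/

/-- The length of the first initial segment of `ω` whose contraction ratio is at most `r`. -/
noncomputable def stopTime {N : ℕ} (lam : Fin N → ℝ) (r : ℝ) (ω : SymbolSpace N) : ℕ :=
  sInf {n | wordProd lam ω n ≤ r}

/-- The image of the reference point `a` in the piece of scale `r` determined by `ω`. -/
noncomputable def stopPoint {d N : ℕ} (f : Fin N → RSpace d → RSpace d) (lam : Fin N → ℝ)
    (a : RSpace d) (r : ℝ) (ω : SymbolSpace N) : RSpace d :=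
  wordMap f ω (stopTime lam r ω) a

section Stop

variable {d N : ℕ} {f : Fin N → RSpace d → RSpace d} {lam : Fin N → ℝ} {a : RSpace d} {c r : ℝ}
  {ω η : SymbolSpace N}

theorem wordProd_stopTime_le (h0 : ∀ i, 0 < lam i) (h1 : ∀ i, lam i < 1) (hr : 0 < r)
    (ω : SymbolSpace N) : wordProd lam ω (stopTime lam r ω) ≤ r :=
  Nat.sInf_mem (s := {n | wordProd lam ω n ≤ r})
    ((tendsto_wordProd_zero h0 h1 ω).eventually (eventually_le_nhds hr)).exists

theorem lt_wordProd_of_lt_stopTime {n : ℕ} (h : n < stopTime lam r ω) : r < wordProd lam ω n :=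
  not_le.1 (Nat.notMem_of_lt_sInf h)

theorem stopTime_eq {n : ℕ} (h : wordProd lam ω n ≤ r) (h' : ∀ k < n, r < wordProd lam ω k) :
    stopTime lam r ω = n :=
  le_antisymm (Nat.sInf_le h) (le_csInf ⟨n, h⟩ fun k hk => by
    by_contra! hlt
    exact absurd hk (not_le.2 (h' k hlt)))

/-- Before the last letter the product still exceeds `r`, and one letter costs at most a factor `c`.
If no letter is read, the product is `1`. -/
theorem mul_le_wordProd_stopTime (hc0 : 0 ≤ c) (hc1 : c ≤ 1) (hc : ∀ i, c ≤ lam i)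
    (hr0 : 0 < r) (hr1 : r ≤ 1) (ω : SymbolSpace N) :
    c * r ≤ wordProd lam ω (stopTime lam r ω) := by
  rcases Nat.eq_zero_or_eq_succ_pred (stopTime lam r ω) with h | h
  · rw [h, wordProd_zero]; nlinarith
  · have := lt_wordProd_of_lt_stopTime (lam := lam) (r := r) (ω := ω)
      (n := (stopTime lam r ω).pred) (by omega)
    rw [h, Nat.succ_eq_add_one, wordProd_succ, mul_comm c]
    exact mul_le_mul this.le (hc _) hc0 (hr0.trans this).le

theorem stopTime_congr (h0 : ∀ i, 0 < lam i) (h1 : ∀ i, lam i < 1) (hr : 0 < r)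
    (h : η ∈ PiNat.cylinder ω (stopTime lam r ω)) : stopTime lam r η = stopTime lam r ω :=
  stopTime_eq (by rw [wordProd_congr h]; exact wordProd_stopTime_le h0 h1 hr ω) fun k hk => by
    rw [wordProd_congr (PiNat.cylinder_anti _ hk.le h)]
    exact lt_wordProd_of_lt_stopTime hk

/-- Pieces of scale `r` are carried by a word to pieces of the rescaled scale. The bound `r ≤ 1`
prevents stopping inside the prefix. -/
theorem stopTime_splice (h0 : ∀ i, 0 < lam i) (h1 : ∀ i, lam i < 1) (hr0 : 0 < r) (hr1 : r ≤ 1)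
    (ω η : SymbolSpace N) (n : ℕ) :
    stopTime lam (wordProd lam ω n * r) (splice ω n η) = n + stopTime lam r η := by
  have hpos := wordProd_pos h0 ω n
  refine stopTime_eq ?_ fun k hk => ?_
  · rw [wordProd_splice_add]
    exact mul_le_mul_of_nonneg_left (wordProd_stopTime_le h0 h1 hr0 η) hpos.le
  · rcases lt_or_ge k n with hkn | hkn
    · rw [wordProd_congr (PiNat.cylinder_anti _ hkn.le (splice_mem_cylinder (n := n)))]
      calc wordProd lam ω n * r ≤ wordProd lam ω n := mul_le_of_le_one_right hpos.le hr1
        _ ≤ wordProd lam ω (k + 1) := wordProd_antitone h0 (fun i => (h1 i).le) ω hkn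
        _ < wordProd lam ω k := by
          rw [wordProd_succ]; exact mul_lt_of_lt_one_right (wordProd_pos h0 ω k) (h1 _)
    · obtain ⟨j, rfl⟩ := Nat.exists_eq_add_of_le hkn
      rw [wordProd_splice_add]
      exact mul_lt_mul_of_pos_left (lt_wordProd_of_lt_stopTime (by omega)) hpos

theorem stopPoint_splice (h0 : ∀ i, 0 < lam i) (h1 : ∀ i, lam i < 1) (hr0 : 0 < r) (hr1 : r ≤ 1)
    (ω η : SymbolSpace N) (n : ℕ) :
    stopPoint f lam a (wordProd lam ω n * r) (splice ω n η)
      = wordMap f ω n (stopPoint f lam a r η) := by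
  rw [stopPoint, stopTime_splice h0 h1 hr0 hr1, wordMap_splice_add]; rfl

theorem stopPoint_congr (h0 : ∀ i, 0 < lam i) (h1 : ∀ i, lam i < 1) (hr : 0 < r)
    (h : η ∈ PiNat.cylinder ω (stopTime lam r ω)) :
    stopPoint f lam a r η = stopPoint f lam a r ω := by
  rw [stopPoint, stopTime_congr h0 h1 hr h, wordMap_congr h]; rfl

/-! ### Consequences of the open set condition -/

/-- Rescaling by `k⁻¹` gives an isometry, which is affine by strict convexity and hence onto in
finite dimension. -/
theorem IsSimilarity.surjective {g : RSpace d → RSpace d} {k : ℝ} (hk : 0 < k)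
    (hg : IsSimilarity g k) : Function.Surjective g := by
  have hiso : Isometry fun x => k⁻¹ • g x := Isometry.of_dist_eq fun x y => by
    rw [dist_smul₀, hg x y, Real.norm_of_nonneg (inv_pos.2 hk).le, inv_mul_cancel_left₀ hk.ne']
  have hsurj : Function.Surjective fun x => k⁻¹ • g x := by
    have := (hiso.affineIsometryOfStrictConvexSpace.toAffineIsometryEquiv rfl).surjective
    simpa using this
  intro y
  obtain ⟨x, hx⟩ := hsurj (k⁻¹ • y)
  exact ⟨x, smul_right_injective _ (inv_pos.2 hk).ne' hx⟩

theorem wordMap_surjective (h0 : ∀ i, 0 < lam i) (hf : ∀ i, IsSimilarity (f i) (lam i))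
    (ω : SymbolSpace N) (n : ℕ) : Function.Surjective (wordMap f ω n) := by
  induction n with
  | zero => exact Function.surjective_id
  | succ n ih => exact ih.comp ((hf _).surjective (h0 _))

theorem ball_subset_image_wordMap (h0 : ∀ i, 0 < lam i) (hf : ∀ i, IsSimilarity (f i) (lam i))
    (ω : SymbolSpace N) (n : ℕ) (ρ : ℝ) :
    Metric.ball (wordMap f ω n a) (wordProd lam ω n * ρ)
      ⊆ wordMap f ω n '' Metric.ball a ρ := by
  intro y hy
  obtain ⟨x, rfl⟩ := wordMap_surjective h0 hf ω n y
  rw [Metric.mem_ball, dist_wordMap hf] at hy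
  exact ⟨x, lt_of_mul_lt_mul_left hy (wordProd_pos h0 ω n).le, rfl⟩

theorem wordMap_image_subset {U : Set (RSpace d)} (hU : ∀ i, f i '' U ⊆ U) (ω : SymbolSpace N)
    (m n : ℕ) : wordMap f ω (m + n) '' U ⊆ wordMap f ω m '' U := by
  induction n with
  | zero => exact subset_rfl
  | succ n ih =>
    rw [← add_assoc, wordMap, Set.image_comp]
    exact (Set.image_mono (hU _)).trans ih

/-- Neither word is a prefix of the other, so both continue past their first difference. There the
images of `U` under the two different letters are disjoint. -/
theorem disjoint_image_wordMap (h0 : ∀ i, 0 < lam i) (hf : ∀ i, IsSimilarity (f i) (lam i))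
    {U : Set (RSpace d)} (hU : ∀ i, f i '' U ⊆ U)
    (hd : ∀ i j, i ≠ j → Disjoint (f i '' U) (f j '' U)) {m n : ℕ}
    (h1 : η ∉ PiNat.cylinder ω m) (h2 : ω ∉ PiNat.cylinder η n) :
    Disjoint (wordMap f ω m '' U) (wordMap f η n '' U) := by
  have hne : ω ≠ η := fun h => h1 (h ▸ PiNat.self_mem_cylinder _ _)
  rw [PiNat.mem_cylinder_iff_le_firstDiff hne.symm, PiNat.firstDiff_comm, not_le] at h1
  rw [PiNat.mem_cylinder_iff_le_firstDiff hne, not_le] at h2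
  set k := PiNat.firstDiff ω η with hk
  have hcyl : ω ∈ PiNat.cylinder η k := PiNat.mem_cylinder_firstDiff _ _
  have hsub : ∀ (ζ : SymbolSpace N) (j : ℕ), k < j →
      wordMap f ζ j '' U ⊆ wordMap f ζ k '' (f (ζ k) '' U) := fun ζ j hj => by
    obtain ⟨i, rfl⟩ := Nat.exists_eq_add_of_le (Nat.succ_le_of_lt hj)
    refine (wordMap_image_subset hU ζ (k + 1) i).trans ?_
    rw [wordMap, Set.image_comp]
  refine Set.disjoint_of_subset (hsub ω m h1) (hsub η n h2) ?_
  rw [wordMap_congr hcyl, Set.disjoint_image_iff (wordMap_injective h0 hf η k)]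
  exact hd _ _ (PiNat.apply_firstDiff_ne hne)

/-- Under the open set condition, the reference points of different pieces of scale `r` are
separated by a multiple of `r`. -/
theorem OpenSetCondition.exists_separated [NeZero N] (hosc : OpenSetCondition f)
    (h0 : ∀ i, 0 < lam i) (h1 : ∀ i, lam i < 1) (hf : ∀ i, IsSimilarity (f i) (lam i)) :
    ∃ (a : RSpace d) (δ : ℝ), 0 < δ ∧ ∀ r, 0 < r → r ≤ 1 → ∀ ω η : SymbolSpace N,
      dist (stopPoint f lam a r ω) (stopPoint f lam a r η) < δ * r →
        η ∈ PiNat.cylinder ω (stopTime lam r ω) := by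
  obtain ⟨U, hUo, -, ⟨a, ha⟩, hU, hd⟩ := hosc
  obtain ⟨ρ, hρ, hball⟩ := Metric.isOpen_iff.1 hUo a ha
  obtain ⟨c, hc0, hc⟩ := exists_pos_forall_le h0
  -- The image of `U` for a piece of scale `r` contains a ball of radius at least `c r ρ` about its
  -- reference point.
  refine ⟨a, c * ρ, by positivity, fun r hr0 hr1 ω η hdist => ?_⟩
  by_contra hn
  have hn' : ω ∉ PiNat.cylinder η (stopTime lam r η) := fun h => hn (by
    rw [stopTime_congr h0 h1 hr0 h, PiNat.mem_cylinder_comm]; exact h)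
  have hdisj := Set.disjoint_left.1 (disjoint_image_wordMap h0 hf hU hd hn hn')
  refine @hdisj (stopPoint f lam a r η) ?_ ⟨a, ha, rfl⟩
  refine Set.image_mono hball (ball_subset_image_wordMap h0 hf _ _ _ ?_)
  rw [Metric.mem_ball, dist_comm]
  refine hdist.trans_le ?_
  have := mul_le_wordProd_stopTime hc0.le ((hc 0).trans (h1 0).le) hc hr0 hr1 ω
  nlinarith

/-- Under the open set condition, the codings of the points of a set of diameter at most `B r` lie
in boundedly many pieces of scale `r`. -/
theorem exists_finset_cover_preimage {δ B : ℝ} (hδ : 0 < δ)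
    (h0 : ∀ i, 0 < lam i) (h1 : ∀ i, lam i < 1) (hf : ∀ i, IsSimilarity (f i) (lam i))
    (hb : Bornology.IsBounded (Set.range (codingMap f)))
    (hsep : ∀ r, 0 < r → r ≤ 1 → ∀ ω η : SymbolSpace N,
      dist (stopPoint f lam a r ω) (stopPoint f lam a r η) < δ * r →
        η ∈ PiNat.cylinder ω (stopTime lam r ω)) :
    ∃ Z : Finset (RSpace d), ∀ r, 0 < r → r ≤ 1 → ∀ S : Set (RSpace d),
      (∀ x ∈ S, ∀ y ∈ S, dist x y ≤ B * r) →
      ∃ C : RSpace d → Set (SymbolSpace N), codingMap f ⁻¹' S ⊆ ⋃ z ∈ Z, C z ∧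
        ∀ z, ∀ ω ∈ C z, ∀ η ∈ C z, η ∈ PiNat.cylinder ω (stopTime lam r ω) := by
  obtain ⟨D, hD⟩ := hb.subset_closedBall a
  -- After translation to a point of `S` and rescaling by `r⁻¹`, all relevant reference points lie
  -- in one fixed ball. A finite `δ / 2`-net of it works for every `r` and `S`, and two reference
  -- points near the same net point are less than `δ r` apart.
  obtain ⟨Z, -, hZf, hZ⟩ := (isCompact_closedBall (0 : RSpace d) (D + B)).finite_cover_balls
    (e := δ / 2) (by positivity)
  refine ⟨hZf.toFinset, fun r hr0 hr1 S hS => ?_⟩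
  rcases S.eq_empty_or_nonempty with rfl | ⟨x, hx⟩
  · exact ⟨fun _ => ∅, by simp, by simp⟩
  refine ⟨fun z => {ω | dist (stopPoint f lam a r ω) (x + r • z) < δ / 2 * r},
    fun ω hω => ?_, fun z ω hω η hη => hsep r hr0 hr1 ω η ?_⟩
  · have hd1 : dist (stopPoint f lam a r ω) (codingMap f ω) ≤ r * D := by
      rw [codingMap_eq_wordMap h1 hf ω (stopTime lam r ω), stopPoint, dist_wordMap hf]
      refine mul_le_mul (wordProd_stopTime_le h0 h1 hr0 ω) ?_ dist_nonneg hr0.le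
      rw [dist_comm]; exact hD ⟨_, rfl⟩
    have hd2 : dist (stopPoint f lam a r ω) x ≤ r * (D + B) := by
      linarith [dist_triangle (stopPoint f lam a r ω) (codingMap f ω) x, hS _ hω _ hx]
    have hmem : r⁻¹ • (stopPoint f lam a r ω - x) ∈ Metric.closedBall (0 : RSpace d) (D + B) := by
      rw [mem_closedBall_zero_iff, norm_smul, Real.norm_of_nonneg (inv_pos.2 hr0).le,
        ← dist_eq_norm, inv_mul_le_iff₀ hr0]
      exact hd2
    obtain ⟨z, hz, hzb⟩ := Set.mem_iUnion₂.1 (hZ hmem)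
    refine Set.mem_iUnion₂.2 ⟨z, by simpa using hz, ?_⟩
    have hrw : stopPoint f lam a r ω - (x + r • z)
        = r • (r⁻¹ • (stopPoint f lam a r ω - x) - z) := by
      rw [smul_sub, smul_inv_smul₀ hr0.ne']; abel
    rw [Metric.mem_ball, dist_eq_norm] at hzb
    rw [Set.mem_ofPred_eq, dist_eq_norm, hrw, norm_smul, Real.norm_of_nonneg hr0.le, mul_comm]
    exact mul_lt_mul_of_pos_right hzb hr0
  · rw [Set.mem_ofPred_eq] at hω hη
    linarith [dist_triangle_right (stopPoint f lam a r ω) (stopPoint f lam a r η) (x + r • z)]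

/-- Under the open set condition there is a word such that every sequence in which it occurs
infinitely often is the only coding of its point. -/
theorem OpenSetCondition.exists_word_unique_coding [NeZero N] (hosc : OpenSetCondition f)
    (h0 : ∀ i, 0 < lam i) (h1 : ∀ i, lam i < 1) (hf : ∀ i, IsSimilarity (f i) (lam i))
    (hb : Bornology.IsBounded (Set.range (codingMap f))) :
    ∃ (ω₀ : SymbolSpace N) (n₀ : ℕ), ∀ ω : SymbolSpace N,
      (∃ᶠ n in atTop, shift^[n] ω ∈ PiNat.cylinder ω₀ n₀) →
        ∀ η, codingMap f η = codingMap f ω → η = ω := by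
  obtain ⟨a, δ, hδ, hsep⟩ := hosc.exists_separated h0 h1 hf
  obtain ⟨Z, hZ⟩ := exists_finset_cover_preimage (B := Metric.diam (Set.range (codingMap f)))
    hδ h0 h1 hf hb hsep
  -- The neighbours of the piece `ω|n`: reference points of the pieces of comparable scale whose
  -- codings hit the same projected cylinder. Their number is bounded uniformly.
  let nb : SymbolSpace N → ℕ → Set (RSpace d) := fun ω n =>
    stopPoint f lam a (wordProd lam ω n) '' (codingMap f ⁻¹' (codingMap f '' PiNat.cylinder ω n))
  have hpos := fun (ω : SymbolSpace N) n => wordProd_pos h0 ω n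
  have hle := fun (ω : SymbolSpace N) n => wordProd_le_one h0 (fun i => (h1 i).le) ω n
  have hnb : ∀ ω n, (nb ω n).Finite ∧ (nb ω n).ncard ≤ Z.card := fun ω n => by
    obtain ⟨C, hC, hC'⟩ := hZ _ (hpos ω n) (hle ω n) (codingMap f '' PiNat.cylinder ω n) (by
      rintro _ ⟨η, hη, rfl⟩ _ ⟨ζ, hζ, rfl⟩
      rw [mul_comm, ← wordProd_congr hζ]
      refine dist_codingMap_le h0 h1 hf hb ?_
      rw [PiNat.mem_cylinder_iff_eq] at hη hζ
      rw [hζ, ← hη]; exact PiNat.self_mem_cylinder _ _)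
    classical
    -- All codings in one cell share a reference point. The default `0` for empty cells is never
    -- needed.
    let g : RSpace d → RSpace d := fun z =>
      if h : (C z).Nonempty then stopPoint f lam a (wordProd lam ω n) h.choose else 0
    have hsub : nb ω n ⊆ (Z.image g : Finset (RSpace d)) := by
      rintro _ ⟨η, hη, rfl⟩
      obtain ⟨z, hz, hzC⟩ := Set.mem_iUnion₂.1 (hC hη)
      have hne : (C z).Nonempty := ⟨η, hzC⟩
      refine Finset.mem_coe.2 (Finset.mem_image.2 ⟨z, hz, ?_⟩)
      simp only [g, hne, dif_pos]
      exact stopPoint_congr h0 h1 (hpos ω n) (hC' z η hzC _ hne.choose_spec)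
    refine ⟨(Finset.finite_toSet _).subset hsub, ?_⟩
    refine (Set.ncard_le_ncard hsub (Finset.finite_toSet _)).trans ?_
    rw [Set.ncard_coe_finset]
    exact Finset.card_image_le
  -- A word with the largest number of neighbours is the required word.
  obtain ⟨⟨ω₀, n₀⟩, hmax⟩ : ∃ x : SymbolSpace N × ℕ, ∀ y : SymbolSpace N × ℕ,
      (nb y.1 y.2).ncard ≤ (nb x.1 x.2).ncard := by
    have hbdd : BddAbove (Set.range fun x : SymbolSpace N × ℕ => (nb x.1 x.2).ncard) :=
      ⟨Z.card, by rintro _ ⟨x, rfl⟩; exact (hnb _ _).2⟩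
    obtain ⟨x, hx⟩ := Nat.sSup_mem (Set.range_nonempty _) hbdd
    exact ⟨x, fun y => by simp only at hx; rw [hx]; exact le_csSup hbdd ⟨y, rfl⟩⟩
  have hprod : ∀ (ω : SymbolSpace N) n, wordProd lam (splice ω n ω₀) (n + n₀)
      = wordProd lam ω n * wordProd lam ω₀ n₀ := fun ω n => wordProd_splice_add
  have hcyl : ∀ (ω : SymbolSpace N) n, ∀ ζ ∈ PiNat.cylinder ω₀ n₀,
      splice ω n ζ ∈ PiNat.cylinder (splice ω n ω₀) (n + n₀) := fun ω n ζ hζ k hk => by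
    rcases lt_or_ge k n with h | h
    · rw [splice_apply_of_lt h, splice_apply_of_lt h]
    · obtain ⟨j, rfl⟩ := Nat.exists_eq_add_of_le h
      rw [splice_apply_add, splice_apply_add]; exact hζ j (by omega)
  -- Prefixing a word maps neighbours injectively to neighbours. By maximality no new ones appear,
  -- so all neighbours of the prefixed piece come from the same prefix.
  have heq : ∀ ω n, wordMap f ω n '' nb ω₀ n₀ = nb (splice ω n ω₀) (n + n₀) := fun ω n => by
    refine Set.eq_of_subset_of_ncard_le ?_ ?_ (hnb _ _).1
    · rintro _ ⟨_, ⟨η, ⟨ζ, hζ, hζη⟩, rfl⟩, rfl⟩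
      refine ⟨splice ω n η, ⟨splice ω n ζ, hcyl ω n ζ hζ, ?_⟩, ?_⟩
      · rw [codingMap_splice h1 hf, codingMap_splice h1 hf, hζη]
      · rw [hprod, stopPoint_splice h0 h1 (hpos _ _) (hle _ _)]
    · rw [Set.ncard_image_of_injective _ (wordMap_injective h0 hf ω n)]
      exact hmax (_, _)
  refine ⟨ω₀, n₀, fun ω hω η hη => funext fun k => ?_⟩
  obtain ⟨n, hn, hkn⟩ := (hω.and_eventually (eventually_gt_atTop k)).exists
  -- Any other coding `η` of the same point is a neighbour at this scale, so it must share the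
  -- prefix of length `n > k`.
  have hmem : stopPoint f lam a (wordProd lam (splice ω n ω₀) (n + n₀)) η
      ∈ nb (splice ω n ω₀) (n + n₀) := by
    refine ⟨η, ⟨ω, ?_, hη.symm⟩, rfl⟩
    have := hcyl ω n _ hn
    rwa [splice_shift_iterate] at this
  rw [← heq] at hmem
  obtain ⟨_, ⟨ζ, -, rfl⟩, hζ⟩ := hmem
  rw [← stopPoint_splice h0 h1 (hpos _ _) (hle _ _), ← hprod] at hζ
  have hmem := hsep _ (hpos _ _) (hle _ _) (splice ω n ζ) η (by
    rw [hζ, dist_self]; exact mul_pos hδ (hpos _ _))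
  rw [hprod, stopTime_splice h0 h1 (hpos _ _) (hle _ _)] at hmem
  rw [hmem k (by omega), splice_apply_of_lt hkn]

end Stop

/-! ### Hausdorff measure and dimension of projections -/

section Hausdorff

variable {d N : ℕ} {f : Fin N → RSpace d → RSpace d} {lam : Fin N → ℝ}

theorem wordProd_le_pow {K : ℝ} (h0 : ∀ i, 0 < lam i) (hK : ∀ i, lam i ≤ K) (ω : SymbolSpace N)
    (n : ℕ) : wordProd lam ω n ≤ K ^ n :=
  wordProd_const K ω n ▸ wordProd_mono (fun i => (h0 i).le) hK ω n

theorem tendsto_ofReal_pow_mul {K : ℝ} (hK0 : 0 ≤ K) (hK1 : K < 1) (D : ℝ) :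
    Tendsto (fun n : ℕ => ENNReal.ofReal (K ^ n * D)) atTop (𝓝 0) := by
  rw [← ENNReal.ofReal_zero]
  refine ENNReal.tendsto_ofReal ?_
  simpa using (tendsto_pow_atTop_nhds_zero_of_lt_one hK0 hK1).mul_const D

/-- The points having a coding with infinitely many initial segments of probability less than
`e^{-am}` form an `s`-dimensional null set as soon as `∑ λ_i^s (p_i e^a)^q < 1` for some
`q ≤ 0`. -/
theorem hausdorffMeasure_frequently_lt_eq_zero [NeZero N]
    (h0 : ∀ i, 0 < lam i) (h1 : ∀ i, lam i < 1) (hf : ∀ i, IsSimilarity (f i) (lam i))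
    (hb : Bornology.IsBounded (Set.range (codingMap f))) {p : Fin N → ℝ} (hp : ∀ i, 0 < p i)
    {a q s : ℝ} (hs : 0 < s) (hq : q ≤ 0) (hsum : pressureSum lam p a q s < 1) :
    μH[s] (codingMap f '' {ω | ∃ᶠ m : ℕ in atTop, wordProd p ω m < Real.exp (-(a * m))}) = 0 := by
  classical
  obtain ⟨K, hK1, hK0, hK⟩ := exists_forall_le_lt_one h1
  set D := Metric.diam (Set.range (codingMap f)) with hD
  have hD0 : 0 ≤ D := Metric.diam_nonneg
  set v : Fin N → ℝ := fun i => lam i ^ s * (p i * Real.exp a) ^ q with hv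
  have hpe : ∀ i, 0 < p i * Real.exp a := fun i => mul_pos (hp i) (Real.exp_pos a)
  have hv0 : ∀ i, 0 < v i := fun i =>
    mul_pos (Real.rpow_pos_of_pos (h0 i) s) (Real.rpow_pos_of_pos (hpe i) q)
  set G := ∑ i, v i with hG
  have hG0 : 0 ≤ G := Finset.sum_nonneg fun i _ => (hv0 i).le
  have hG1 : G < 1 := hsum
  -- Only words of length at least `M` enter, and the words that are not bad contribute the empty
  -- set.
  let t : ∀ M : ℕ, (Σ k : ℕ, (Fin (M + k) → Fin N)) → Set (RSpace d) := fun M c =>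
    if wordProd p (extendWord c.2) (M + c.1) < Real.exp (-(a * (M + c.1 : ℕ))) then
      codingMap f '' PiNat.cylinder (extendWord c.2) (M + c.1) else ∅
  have hterm : ∀ M c, Metric.ediam (t M c) ^ s
      ≤ ENNReal.ofReal (D ^ s) * ENNReal.ofReal (wordProd v (extendWord c.2) (M + c.1)) := by
    intro M c
    simp only [t]
    split_ifs with hbad
    · refine (ENNReal.rpow_le_rpow (ediam_image_cylinder_le h0 h1 hf hb _ _) hs.le).trans ?_
      have hpos := wordProd_pos h0 (extendWord c.2) (M + c.1)
      rw [ENNReal.ofReal_rpow_of_nonneg (mul_nonneg hpos.le hD0) hs.le,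
        ← ENNReal.ofReal_mul (by positivity)]
      refine ENNReal.ofReal_le_ofReal ?_
      rw [Real.mul_rpow hpos.le hD0, mul_comm]
      refine mul_le_mul_of_nonneg_left ?_ (by positivity)
      rw [hv, wordProd_mul, wordProd_rpow h0, wordProd_rpow hpe]
      -- Badness means `p(w) e^{am} < 1`, so its `q`-th power is at least `1` because `q ≤ 0`.
      refine le_mul_of_one_le_right (by positivity) ?_
      refine Real.one_le_rpow_of_pos_of_le_one_of_nonpos (wordProd_pos hpe _ _) ?_ hq
      rw [wordProd_mul, wordProd_const, ← Real.exp_nat_mul, mul_comm ((M + c.1 : ℕ) : ℝ)]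
      calc _ ≤ Real.exp (-(a * (M + c.1 : ℕ))) * Real.exp (a * (M + c.1 : ℕ)) := by gcongr
        _ = 1 := by rw [← Real.exp_add]; simp
    · rw [Metric.ediam_empty, ENNReal.zero_rpow_of_pos hs]; exact zero_le
  -- The weights `v` multiply along words, so the words of length `n` contribute `G^n`: this is the
  -- tail of a geometric series.
  have hsumM : ∀ M, ∑' c, Metric.ediam (t M c) ^ s
      ≤ ∑' k, ENNReal.ofReal (D ^ s) * ENNReal.ofReal G ^ (k + M) := fun M => by
    refine (ENNReal.tsum_le_tsum (hterm M)).trans ?_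
    rw [ENNReal.tsum_sigma' fun c : Σ k : ℕ, (Fin (M + k) → Fin N) => ENNReal.ofReal (D ^ s)
      * ENNReal.ofReal (wordProd v (extendWord c.2) (M + c.1))]
    refine ENNReal.tsum_le_tsum fun k => ?_
    rw [tsum_fintype, ← Finset.mul_sum,
      ← ENNReal.ofReal_sum_of_nonneg fun w _ => (wordProd_pos hv0 _ _).le]
    simp only [wordProd_extendWord, sum_prod_words]
    rw [← ENNReal.ofReal_pow hG0, add_comm M k]
  have htail : Tendsto (fun M => ∑' k, ENNReal.ofReal (D ^ s) * ENNReal.ofReal G ^ (k + M)) atTop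
      (𝓝 0) := by
    refine ENNReal.tendsto_sum_nat_add (fun k => ENNReal.ofReal (D ^ s) * ENNReal.ofReal G ^ k) ?_
    rw [ENNReal.tsum_mul_left, ENNReal.tsum_geometric]
    refine ENNReal.mul_ne_top ENNReal.ofReal_ne_top (ENNReal.inv_ne_top.2 ?_)
    exact (tsub_pos_of_lt (ENNReal.ofReal_lt_one.2 hG1)).ne'
  refine le_antisymm ?_ zero_le
  rw [← htail.liminf_eq]
  refine (Measure.hausdorffMeasure_le_liminf_tsum s _ (fun M => ENNReal.ofReal (K ^ M * D))
    (tendsto_ofReal_pow_mul hK0.le hK1 D) t (Eventually.of_forall fun M c => ?_)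
    (Eventually.of_forall fun M => ?_)).trans (liminf_le_liminf (Eventually.of_forall hsumM))
  · simp only [t]
    split_ifs
    · refine (ediam_image_cylinder_le h0 h1 hf hb _ _).trans (ENNReal.ofReal_le_ofReal ?_)
      refine mul_le_mul_of_nonneg_right ?_ hD0
      exact (wordProd_le_pow h0 hK _ _).trans
        (pow_le_pow_of_le_one hK0.le hK1.le (Nat.le_add_right _ _))
    · simp
  · rintro _ ⟨ω, hω, rfl⟩
    obtain ⟨m, hm, hbad⟩ := frequently_atTop.1 hω M
    obtain ⟨k, rfl⟩ := Nat.exists_eq_add_of_le hm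
    have hcyl := extendWord_restrict_mem_cylinder ω (M + k)
    refine Set.mem_iUnion.2 ⟨⟨k, fun i => ω i⟩, ?_⟩
    simp only [t]
    rw [wordProd_congr hcyl, if_pos hbad]
    exact ⟨ω, (PiNat.mem_cylinder_comm _ _ _).1 hcyl, rfl⟩

theorem exists_cylinder_subset {V : Set (SymbolSpace N)} (hV : IsOpen V) {ω : SymbolSpace N}
    (hω : ω ∈ V) (M : ℕ) : ∃ n, M ≤ n ∧ PiNat.cylinder ω n ⊆ V := by
  obtain ⟨_, ⟨x, n, rfl⟩, hx, hsub⟩ :=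
    (PiNat.isTopologicalBasis_cylinders fun _ => Fin N).isOpen_iff.1 hV ω hω
  refine ⟨max M n, le_max_left _ _, (PiNat.cylinder_anti _ (le_max_right _ _)).trans ?_⟩
  rwa [PiNat.mem_cylinder_iff_eq.1 hx]

/-- The Hausdorff measure in the similarity dimension of a projection is controlled by the Bernoulli
measure with weights `λ_i^t`. -/
theorem hausdorffMeasure_image_codingMap_le [NeZero N]
    (h0 : ∀ i, 0 < lam i) (h1 : ∀ i, lam i < 1) (hf : ∀ i, IsSimilarity (f i) (lam i))
    (hb : Bornology.IsBounded (Set.range (codingMap f))) {t : ℝ} (ht : 0 ≤ t)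
    (hsum : ∑ i, lam i ^ t = 1) (A : Set (SymbolSpace N)) :
    μH[t] (codingMap f '' A)
      ≤ ENNReal.ofReal ((Metric.diam (Set.range (codingMap f)) + 1) ^ t)
        * bernoulliMeasure (fun i => lam i ^ t) A := by
  have hlt : ∀ i, 0 < lam i ^ t := fun i => Real.rpow_pos_of_pos (h0 i) t
  have := isProbabilityMeasure_bernoulliMeasure hlt hsum
  obtain ⟨K, hK1, hK0, hK⟩ := exists_forall_le_lt_one h1
  -- Adding `1` keeps the constant nonzero, so that it can be moved through the infima over open
  -- supersets.
  set D := Metric.diam (Set.range (codingMap f)) + 1 with hD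
  have hD0 : 0 < D := by have := Metric.diam_nonneg (s := Set.range (codingMap f)); linarith
  have hdiam : ∀ (ω : SymbolSpace N) n, Metric.ediam (codingMap f '' PiNat.cylinder ω n)
      ≤ ENNReal.ofReal (wordProd lam ω n * D) := fun ω n =>
    (ediam_image_cylinder_le h0 h1 hf hb ω n).trans (ENNReal.ofReal_le_ofReal
      (mul_le_mul_of_nonneg_left (by linarith) (wordProd_pos h0 ω n).le))
  have hDt : ENNReal.ofReal (D ^ t) ≠ 0 := by simp; positivity
  rw [A.measure_eq_iInf_isOpen, ENNReal.mul_iInf_of_ne hDt ENNReal.ofReal_ne_top]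
  refine le_iInf fun V => ?_
  rw [ENNReal.mul_iInf_of_ne hDt ENNReal.ofReal_ne_top]
  refine le_iInf fun hAV => ?_
  rw [ENNReal.mul_iInf_of_ne hDt ENNReal.ofReal_ne_top]
  refine le_iInf fun hV => ?_
  -- The shortest cylinders of length at least `M` inside `V`. They are disjoint, so their diameters
  -- to the power `t` sum to at most a constant times the mass of `V`.
  let ι : ℕ → Type := fun M => {c : Σ m : ℕ, (Fin m → Fin N) // M ≤ c.1 ∧
    PiNat.cylinder (extendWord c.2) c.1 ⊆ V ∧
    ∀ j < c.1, M ≤ j → ¬ PiNat.cylinder (extendWord c.2) j ⊆ V}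
  let cyl : ∀ M, ι M → Set (SymbolSpace N) := fun M c =>
    PiNat.cylinder (extendWord c.1.2) c.1.1
  have hdisj : ∀ M, Pairwise (Function.onFun Disjoint (cyl M)) := by
    rintro M ⟨⟨m, w⟩, hm, hmV, hmin⟩ ⟨⟨m', w'⟩, hm', hmV', hmin'⟩ hne
    rw [Function.onFun, Set.disjoint_left]
    intro η hη hη'
    refine hne ?_
    simp only [cyl] at *
    have e1 := fun j (hj : j ≤ m) =>
      PiNat.mem_cylinder_iff_eq.1 (PiNat.cylinder_anti _ hj hη)
    have e2 := fun j (hj : j ≤ m') =>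
      PiNat.mem_cylinder_iff_eq.1 (PiNat.cylinder_anti _ hj hη')
    rcases lt_trichotomy m m' with h | h | h
    · exact absurd (by rwa [← e2 m h.le, e1 m le_rfl]) (hmin' m h hm)
    · subst h
      have : w = w' := funext fun k => by
        rw [← extendWord_apply w, ← extendWord_apply w', ← hη k k.2, ← hη' k k.2]
      subst this; rfl
    · exact absurd (by rwa [← e1 m' h.le, e2 m' le_rfl]) (hmin m' h hm')
  refine (Measure.hausdorffMeasure_le_liminf_tsum (ι := ι) (l := atTop) t _
    (fun M => ENNReal.ofReal (K ^ M * D)) (tendsto_ofReal_pow_mul hK0.le hK1 D)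
    (fun M c => codingMap f '' cyl M c) (Eventually.of_forall fun M c => ?_)
    (Eventually.of_forall fun M => ?_)).trans ?_
  · refine (hdiam _ _).trans (ENNReal.ofReal_le_ofReal
      (mul_le_mul_of_nonneg_right ?_ hD0.le))
    exact (wordProd_le_pow h0 hK _ _).trans (pow_le_pow_of_le_one hK0.le hK1.le c.2.1)
  · classical
    rintro _ ⟨ω, hω, rfl⟩
    have hex := exists_cylinder_subset hV (hAV hω) M
    have hcyl := extendWord_restrict_mem_cylinder ω (Nat.find hex)
    have heq := fun j (hj : j ≤ Nat.find hex) =>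
      PiNat.mem_cylinder_iff_eq.1 (PiNat.cylinder_anti _ hj hcyl)
    refine Set.mem_iUnion.2 ⟨⟨⟨Nat.find hex, fun i => ω i⟩, (Nat.find_spec hex).1, ?_, ?_⟩,
      ω, (PiNat.mem_cylinder_comm _ _ _).1 hcyl, rfl⟩
    · exact (heq _ le_rfl).trans_subset (Nat.find_spec hex).2
    · intro j hj hMj hsub
      exact Nat.find_min hex hj ⟨hMj, (heq j hj.le).symm.trans_subset hsub⟩
  · refine (liminf_le_liminf (v := fun _ => ENNReal.ofReal (D ^ t)
      * bernoulliMeasure (fun i => lam i ^ t) V) (Eventually.of_forall fun M => ?_)).trans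
      (by simp)
    have hterm : ∀ c, Metric.ediam (codingMap f '' cyl M c) ^ t
        ≤ ENNReal.ofReal (D ^ t) * bernoulliMeasure (fun i => lam i ^ t) (cyl M c) := fun c => by
      refine (ENNReal.rpow_le_rpow (hdiam _ _) ht).trans ?_
      have hpos := wordProd_pos h0 (extendWord c.1.2) c.1.1
      rw [ENNReal.ofReal_rpow_of_nonneg (by positivity) ht, bernoulliMeasure_cylinder hlt hsum,
        wordProd_rpow h0, ← ENNReal.ofReal_mul (by positivity), Real.mul_rpow hpos.le hD0.le,
        mul_comm]
    refine (ENNReal.tsum_le_tsum hterm).trans ?_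
    rw [ENNReal.tsum_mul_left, ← measure_iUnion (hdisj M) fun c => measurableSet_cylinder _ _]
    gcongr
    exact Set.iUnion_subset fun c => c.2.2.1

/-- Mass distribution principle: if the cylinders of almost every sequence have mass at most the
`s`-th power of their diameter, then sets charged by the projected measure have dimension at
least `s`. -/
theorem le_dimH_of_ae_mem [NeZero N] (hosc : OpenSetCondition f)
    (h0 : ∀ i, 0 < lam i) (h1 : ∀ i, lam i < 1) (hf : ∀ i, IsSimilarity (f i) (lam i))
    (hb : Bornology.IsBounded (Set.range (codingMap f)))
    {m : Fin N → ℝ} (hm : ∀ i, 0 < m i) (hm1 : ∑ i, m i = 1) {s : ℝ≥0}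
    (hms : ∀ᵐ ω ∂(bernoulliMeasure m), ∀ᶠ n in atTop,
      wordProd m ω n ≤ wordProd lam ω n ^ (s : ℝ))
    {E : Set (RSpace d)} (hE : ∀ᵐ ω ∂(bernoulliMeasure m), codingMap f ω ∈ E) :
    (s : ℝ≥0∞) ≤ dimH E := by
  have := isProbabilityMeasure_bernoulliMeasure hm hm1
  have hs0 : (0 : ℝ) ≤ s := s.2
  have hπ : Measurable (codingMap f) := (continuous_codingMap h0 h1 hf hb).measurable
  obtain ⟨a, δ, hδ, hsep⟩ := hosc.exists_separated h0 h1 hf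
  obtain ⟨Z, hZ⟩ := exists_finset_cover_preimage (B := 1) hδ h0 h1 hf hb hsep
  -- The mass bound is made uniform: almost every sequence lies in some `A k`, so one of these sets
  -- has positive mass.
  let A : ℕ → Set (SymbolSpace N) := fun k =>
    {ω | ∀ n, wordProd m ω n ≤ (k + 1) * wordProd lam ω n ^ (s : ℝ)}
  have hAm : ∀ k, MeasurableSet (A k) := fun k => by
    simp only [A, Set.ofPred_forall]
    exact .iInter fun n => measurableSet_le (measurable_wordProd m n)
      (((measurable_wordProd lam n).pow_const _).const_mul _)
  obtain ⟨k, hk⟩ : ∃ k, bernoulliMeasure m (A k) ≠ 0 := by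
    by_contra! hall
    have hnull := measure_iUnion_null hall
    obtain ⟨ω, hω, hωn⟩ := (hms.and (measure_eq_zero_iff_ae_notMem.1 hnull)).exists
    obtain ⟨n₀, hn₀⟩ := eventually_atTop.1 hω
    have hpos : 0 < wordProd lam ω n₀ ^ (s : ℝ) := Real.rpow_pos_of_pos (wordProd_pos h0 ω n₀) _
    obtain ⟨k, hk⟩ := exists_nat_ge (1 / wordProd lam ω n₀ ^ (s : ℝ))
    refine hωn (Set.mem_iUnion.2 ⟨k, fun n => ?_⟩)
    have hposn : 0 < wordProd lam ω n ^ (s : ℝ) := Real.rpow_pos_of_pos (wordProd_pos h0 ω n) _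
    rcases le_or_gt n₀ n with h | h
    · refine (hn₀ n h).trans (le_mul_of_one_le_left hposn.le ?_)
      linarith [(k.cast_nonneg : (0 : ℝ) ≤ k)]
    · rw [div_le_iff₀ hpos] at hk
      have hm_le : ∀ i, m i ≤ 1 := fun i =>
        hm1 ▸ Finset.single_le_sum (fun i _ => (hm i).le) (Finset.mem_univ i)
      calc wordProd m ω n ≤ 1 := wordProd_le_one hm hm_le ω n
        _ ≤ k * wordProd lam ω n₀ ^ (s : ℝ) := hk
        _ ≤ (k + 1) * wordProd lam ω n ^ (s : ℝ) := by
          refine mul_le_mul (by linarith) (Real.rpow_le_rpow (wordProd_pos h0 ω n₀).le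
            (wordProd_antitone h0 (fun i => (h1 i).le) ω h.le) hs0) hpos.le (by positivity)
  -- A set of diameter at most `r` is met by at most `Z.card` pieces. The extra `1` keeps `C`
  -- positive even if `Z` is empty.
  set C : ℝ := (Z.card + 1) * (k + 1) with hC
  have hC0 : 0 < C := by positivity
  have hmass : ∀ r, 0 < r → r ≤ 1 → ∀ S : Set (RSpace d),
      (∀ x ∈ S, ∀ y ∈ S, dist x y ≤ r) →
      bernoulliMeasure m (codingMap f ⁻¹' S ∩ A k) ≤ ENNReal.ofReal (C * r ^ (s : ℝ)) := by
    intro r hr0 hr1 S hS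
    obtain ⟨T, hT, hT'⟩ := hZ r hr0 hr1 S (by simpa using hS)
    have hpiece : ∀ z, bernoulliMeasure m (T z ∩ A k)
        ≤ ENNReal.ofReal ((k + 1) * r ^ (s : ℝ)) := fun z => by
      rcases (T z ∩ A k).eq_empty_or_nonempty with h | ⟨ω, hωT, hωA⟩
      · simp [h]
      · have hsub : T z ∩ A k ⊆ PiNat.cylinder ω (stopTime lam r ω) := fun η hη =>
          hT' z ω hωT η hη.1
        refine (measure_mono hsub).trans ?_
        rw [bernoulliMeasure_cylinder hm hm1]
        refine ENNReal.ofReal_le_ofReal ((hωA _).trans ?_)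
        gcongr
        · exact (wordProd_pos h0 ω _).le
        · exact wordProd_stopTime_le h0 h1 hr0 ω
    calc bernoulliMeasure m (codingMap f ⁻¹' S ∩ A k)
        ≤ bernoulliMeasure m (⋃ z ∈ Z, T z ∩ A k) := measure_mono fun ω hω => by
          obtain ⟨z, hz, hzT⟩ := Set.mem_iUnion₂.1 (hT hω.1)
          exact Set.mem_iUnion₂.2 ⟨z, hz, hzT, hω.2⟩
      _ ≤ ∑ z ∈ Z, bernoulliMeasure m (T z ∩ A k) := measure_biUnion_finset_le _ _
      _ ≤ ∑ z ∈ Z, ENNReal.ofReal ((k + 1) * r ^ (s : ℝ)) := Finset.sum_le_sum fun z _ => hpiece z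
      _ = ENNReal.ofReal (Z.card * ((k + 1) * r ^ (s : ℝ))) := by
          rw [Finset.sum_const, nsmul_eq_mul, ENNReal.ofReal_mul (Nat.cast_nonneg Z.card),
            ENNReal.ofReal_natCast]
      _ ≤ ENNReal.ofReal (C * r ^ (s : ℝ)) := by
          refine ENNReal.ofReal_le_ofReal ?_
          rw [hC, mul_assoc]
          gcongr
          linarith
  set ν := Measure.map (codingMap f) ((bernoulliMeasure m).restrict (A k)) with hν
  have hνle : (ENNReal.ofReal C)⁻¹ • ν ≤ μH[(s : ℝ)] := by
    refine Measure.le_hausdorffMeasure _ _ (1 / 2) (by simp) fun S hS => ?_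
    have hStop : Metric.ediam S ≠ ∞ := (hS.trans_lt (by simp)).ne
    set D := (Metric.ediam S).toReal with hD
    have hD1 : D < 1 := by
      have := ENNReal.toReal_mono (by simp) hS
      simp only [one_div, ENNReal.toReal_inv, ENNReal.toReal_ofNat] at this
      linarith
    -- The set `S` may have diameter zero and need not be measurable. Hence a slightly larger `r`,
    -- followed by a limit, and the closure, which has the same diameter.
    have hbound : ∀ r, D < r → r < 1 → ν S ≤ ENNReal.ofReal (C * r ^ (s : ℝ)) := by
      intro r hDr hr1
      refine (measure_mono subset_closure).trans ?_
      rw [hν, Measure.map_apply hπ isClosed_closure.measurableSet,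
        Measure.restrict_apply (hπ isClosed_closure.measurableSet)]
      refine hmass r (ENNReal.toReal_nonneg.trans_lt hDr) hr1.le _ fun x hx y hy => ?_
      have h := Metric.edist_le_ediam_of_mem hx hy
      rw [Metric.ediam_closure] at h
      rw [dist_edist]
      exact (ENNReal.toReal_mono hStop h).trans hDr.le
    have hlim : ν S ≤ ENNReal.ofReal (C * D ^ (s : ℝ)) := by
      have hcont : Tendsto (fun r : ℝ => ENNReal.ofReal (C * r ^ (s : ℝ))) (𝓝[>] D)
          (𝓝 (ENNReal.ofReal (C * D ^ (s : ℝ)))) := by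
        refine ENNReal.tendsto_ofReal (Tendsto.const_mul _ ?_)
        exact ((Real.continuous_rpow_const hs0).tendsto D).mono_left nhdsWithin_le_nhds
      refine ge_of_tendsto hcont ?_
      filter_upwards [Ioo_mem_nhdsGT hD1] with r hr using hbound r hr.1 hr.2
    rw [Measure.smul_apply, smul_eq_mul]
    refine (mul_le_mul_right hlim _).trans ?_
    rw [ENNReal.ofReal_mul hC0.le, ← mul_assoc, ENNReal.inv_mul_cancel (by simpa using hC0)
      ENNReal.ofReal_ne_top, one_mul, ← ENNReal.ofReal_rpow_of_nonneg ENNReal.toReal_nonneg hs0,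
      ENNReal.ofReal_toReal hStop]
  refine le_dimH_of_hausdorffMeasure_ne_zero fun hzero => ?_
  have h1 := hνle E
  rw [hzero, Measure.smul_apply, smul_eq_mul, nonpos_iff_eq_zero, mul_eq_zero] at h1
  have h2 : ν E = 0 := h1.resolve_left (ENNReal.inv_ne_zero.2 ENNReal.ofReal_ne_top)
  -- `E` need not be measurable; the inequality for outer measures suffices.
  have h3 : (bernoulliMeasure m).restrict (A k) (codingMap f ⁻¹' E) = 0 :=
    le_antisymm ((Measure.le_map_apply hπ.aemeasurable E).trans h2.le) zero_le
  have h4 : (bernoulliMeasure m).restrict (A k) (codingMap f ⁻¹' E)ᶜ = 0 :=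
    ae_restrict_of_ae hE
  refine hk ?_
  have h5 := measure_union_null h3 h4
  rwa [Set.union_compl_self, Measure.restrict_apply_univ] at h5

end Hausdorff

/-! ### The pressure and the choice of weights -/

section Pressure

variable {N : ℕ} {lam p : Fin N → ℝ}

theorem strictAnti_pressureSum [NeZero N] (h0 : ∀ i, 0 < lam i) (h1 : ∀ i, lam i < 1)
    (hp : ∀ i, 0 < p i) (α q : ℝ) : StrictAnti (pressureSum lam p α q) := fun s t hst => by
  refine Finset.sum_lt_sum_of_nonempty ⟨0, Finset.mem_univ _⟩ fun i _ => ?_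
  exact mul_lt_mul_of_pos_right (Real.rpow_lt_rpow_of_exponent_gt (h0 i) (h1 i) hst)
    (Real.rpow_pos_of_pos (mul_pos (hp i) (Real.exp_pos α)) q)

theorem pressureSum_lt_one_iff [NeZero N] (h0 : ∀ i, 0 < lam i) (h1 : ∀ i, lam i < 1)
    (hp : ∀ i, 0 < p i) {α q s : ℝ} : pressureSum lam p α q s < 1 ↔ pressure lam p α q < s := by
  rw [← pressureSum_pressure h0 h1 hp α q, (strictAnti_pressureSum h0 h1 hp α q).lt_iff_gt]

theorem pressureSum_eq_sum_exp (hp : ∀ i, 0 < p i) (α q s : ℝ) :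
    pressureSum lam p α q s = ∑ i, lam i ^ s * Real.exp (q * (Real.log (p i) + α)) := by
  refine Finset.sum_congr rfl fun i _ => ?_
  rw [Real.rpow_def_of_pos (mul_pos (hp i) (Real.exp_pos α)),
    Real.log_mul (hp i).ne' (Real.exp_pos α).ne', Real.log_exp, mul_comm q]

/-- Changing `α` only rescales the sum, by a factor near `1` on bounded ranges of `q`. -/
theorem pressureSum_eq_exp_mul (hp : ∀ i, 0 < p i) (α α' q s : ℝ) :
    pressureSum lam p α' q s = Real.exp (q * (α' - α)) * pressureSum lam p α q s := by
  rw [pressureSum_eq_sum_exp hp, pressureSum_eq_sum_exp hp, Finset.mul_sum]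
  refine Finset.sum_congr rfl fun i _ => ?_
  rw [mul_left_comm, ← Real.exp_add]; ring_nf

theorem continuous_pressureSum (hp : ∀ i, 0 < p i) (α s : ℝ) :
    Continuous fun q => pressureSum lam p α q s := by
  simp only [pressureSum_eq_sum_exp hp]; fun_prop

/-- For `q < 0` and a nonpositive exponent the term of a letter with `p_i e^α < 1` alone would
exceed `1`. -/
theorem pressure_pos [NeZero N] (h0 : ∀ i, 0 < lam i) (h1 : ∀ i, lam i < 1) (hp : ∀ i, 0 < p i)
    {α q : ℝ} (hq : q < 0) (hi : ∃ i, p i * Real.exp α < 1) : 0 < pressure lam p α q := by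
  obtain ⟨i, hi⟩ := hi
  by_contra! hle
  have hpe := fun i => mul_pos (hp i) (Real.exp_pos α)
  have h := pressureSum_pressure h0 h1 hp α q
  have h2 : lam i ^ pressure lam p α q * (p i * Real.exp α) ^ q ≤ 1 := by
    rw [← h]
    exact Finset.single_le_sum (f := fun i => lam i ^ pressure lam p α q * (p i * Real.exp α) ^ q)
      (fun j _ => (mul_pos (Real.rpow_pos_of_pos (h0 j) _) (Real.rpow_pos_of_pos (hpe j) _)).le)
      (Finset.mem_univ i)
  have h3 : 1 ≤ lam i ^ pressure lam p α q :=
    Real.one_le_rpow_of_pos_of_le_one_of_nonpos (h0 i) (h1 i).le hle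
  have h4 : 1 < (p i * Real.exp α) ^ q :=
    Real.one_lt_rpow_of_pos_of_lt_one_of_neg (hpe i) hi hq
  nlinarith

/-- At fixed `s` every term tends to `0` as `q → -∞`. -/
theorem exists_pressure_lt [NeZero N] (h0 : ∀ i, 0 < lam i) (h1 : ∀ i, lam i < 1)
    (hp : ∀ i, 0 < p i) {α : ℝ} (hi : ∀ i, 1 < p i * Real.exp α) (s : ℝ) :
    ∃ q < 0, pressure lam p α q < s := by
  have ht : Tendsto (fun q => pressureSum lam p α q s) atBot (𝓝 (∑ i : Fin N, lam i ^ s * 0)) :=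
    tendsto_finsetSum _ fun i _ => (tendsto_rpow_atBot_of_base_gt_one _ (hi i)).const_mul _
  simp only [mul_zero, Finset.sum_const_zero] at ht
  obtain ⟨q, hq, hq0⟩ := ((ht.eventually (gt_mem_nhds one_pos)).and (eventually_lt_atBot 0)).exists
  exact ⟨q, hq0, (pressureSum_lt_one_iff h0 h1 hp).1 hq⟩

theorem tendsto_mul_exp_atBot {c b : ℝ} (hc : 0 < c) (hb : b < 0) :
    Tendsto (fun q => c * Real.exp (q * b)) atBot atTop :=
  (Real.tendsto_exp_atTop.comp (tendsto_id.atBot_mul_const_of_neg hb)).const_mul_atTop hc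

/-- A strict lower bound for the pressure persists for a slightly larger parameter. -/
theorem exists_gt_forall_one_lt_pressureSum [NeZero N] (h0 : ∀ i, 0 < lam i)
    (h1 : ∀ i, lam i < 1) (hp : ∀ i, 0 < p i) {α s s' : ℝ} (hss : s < s')
    (hi : ∃ i, Real.log (p i) + α < 0) (hsum : ∀ q < 0, 1 ≤ pressureSum lam p α q s') :
    ∃ α' > α, (∃ i, Real.log (p i) + α' < 0) ∧ ∀ q ≤ 0, 1 < pressureSum lam p α' q s := by
  obtain ⟨i, hi⟩ := hi
  obtain ⟨K, hK1, hK0, hK⟩ := exists_forall_le_lt_one h1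
  -- Lowering the exponent from `s'` to `s` gains at least the factor `κ > 1`, uniformly in `q`.
  -- Half of `log κ` will be spent on raising `α`.
  set κ := K ^ (s - s') with hκ
  have hκ1 : 1 < κ := Real.one_lt_rpow_of_pos_of_lt_one_of_neg hK0 hK1 (by linarith)
  have hlog : 0 < Real.log κ := Real.log_pos hκ1
  have hsum' : ∀ q ≤ 0, 1 ≤ pressureSum lam p α q s' := fun q hq => by
    rcases hq.lt_or_eq with h | rfl
    · exact hsum q h
    · have hlim : Tendsto (fun q => pressureSum lam p α q s') (𝓝[<] (0 : ℝ))
          (𝓝 (pressureSum lam p α 0 s')) :=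
        ((continuous_pressureSum hp α s').tendsto 0).mono_left nhdsWithin_le_nhds
      refine ge_of_tendsto hlim ?_
      filter_upwards [self_mem_nhdsWithin] with q hq using hsum q hq
  have hκs : ∀ q ≤ 0, κ ≤ pressureSum lam p α q s := fun q hq => by
    refine (le_mul_of_one_le_right (by positivity) (hsum' q hq)).trans ?_
    rw [pressureSum, pressureSum, Finset.mul_sum]
    refine Finset.sum_le_sum fun i _ => ?_
    rw [← mul_assoc]
    refine mul_le_mul_of_nonneg_right ?_
      (Real.rpow_pos_of_pos (mul_pos (hp i) (Real.exp_pos α)) q).le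
    calc κ * lam i ^ s' ≤ lam i ^ (s - s') * lam i ^ s' := by
          refine mul_le_mul_of_nonneg_right ?_ (Real.rpow_pos_of_pos (h0 i) _).le
          exact Real.rpow_le_rpow_of_nonpos (h0 i) (hK i) (by linarith)
      _ = lam i ^ s := by rw [← Real.rpow_add (h0 i)]; ring_nf
  -- For very negative `q` the single letter `i` already makes the sum exceed `1`, uniformly in
  -- parameters up to `α₁`. This leaves a bounded range of `q`.
  obtain ⟨α₁, hα₁, hα₁'⟩ := exists_between (show α < -Real.log (p i) by linarith)
  obtain ⟨Q, hQ⟩ := eventually_atBot.1 ((tendsto_mul_exp_atBot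
    (Real.rpow_pos_of_pos (h0 i) s) (show Real.log (p i) + α₁ < 0 by linarith)).eventually_gt_atTop
      1)
  set Q' := max (-Q) 1 with hQ'
  have hQ'0 : 0 < Q' := lt_max_of_lt_right one_pos
  -- On `[-Q', 0]` this increment costs at most the factor `e^{-(log κ)/2}`.
  have hstep : 0 < Real.log κ / (2 * Q') := div_pos hlog (mul_pos two_pos hQ'0)
  set α' := min α₁ (α + Real.log κ / (2 * Q')) with hα'
  have hα'l : α' ≤ α₁ := min_le_left _ _
  have hα'r : α' ≤ α + Real.log κ / (2 * Q') := min_le_right _ _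
  refine ⟨α', lt_min hα₁ (by linarith),
    ⟨i, by linarith⟩, fun q hq => ?_⟩
  rcases le_or_gt q Q with h | h
  · refine (hQ q h).trans_le ?_
    rw [pressureSum_eq_sum_exp hp]
    calc lam i ^ s * Real.exp (q * (Real.log (p i) + α₁))
        ≤ lam i ^ s * Real.exp (q * (Real.log (p i) + α')) := by
          refine mul_le_mul_of_nonneg_left (Real.exp_le_exp.2 ?_) (Real.rpow_pos_of_pos (h0 i) _).le
          exact mul_le_mul_of_nonpos_left (by linarith) hq
      _ ≤ _ := Finset.single_le_sum
          (f := fun i => lam i ^ s * Real.exp (q * (Real.log (p i) + α')))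
          (fun j _ => (mul_pos (Real.rpow_pos_of_pos (h0 j) _) (Real.exp_pos _)).le)
          (Finset.mem_univ i)
  · rw [pressureSum_eq_exp_mul hp α]
    have hαα' : 0 ≤ α' - α := by
      rw [sub_nonneg]; exact le_min hα₁.le (by linarith)
    have hαle : (α' - α) * Q' ≤ Real.log κ / 2 := by
      have h2 : α' - α ≤ Real.log κ / (2 * Q') := by linarith
      calc (α' - α) * Q' ≤ Real.log κ / (2 * Q') * Q' := by gcongr
        _ = Real.log κ / 2 := by field_simp
    have hqQ : -Q' ≤ q := by linarith [le_max_left (-Q) 1]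
    calc (1 : ℝ) < Real.exp (-(Real.log κ / 2)) * κ := by
          nth_rewrite 2 [← Real.exp_log (zero_lt_one.trans hκ1)]
          rw [← Real.exp_add, Real.one_lt_exp_iff]; linarith
      _ ≤ Real.exp (q * (α' - α)) * pressureSum lam p α q s :=
          mul_le_mul (Real.exp_le_exp.2 (by nlinarith)) (hκs q hq) (by linarith)
            (Real.exp_pos _).le

/-- First-order conditions for the minimum of a sum of exponentials on the negative half-line. -/
theorem exists_nonpos_sum_exp_deriv {c b : Fin N → ℝ} (hc : ∀ i, 0 < c i) (hb : ∃ i, b i < 0) :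
    ∃ q ≤ 0, ∑ i, c i * Real.exp (q * b i) * b i ≤ 0 ∧
      q * ∑ i, c i * Real.exp (q * b i) * b i = 0 := by
  obtain ⟨j, hj⟩ := hb
  set g : ℝ → ℝ := fun q => ∑ i, c i * Real.exp (q * b i) with hg
  have hderiv : ∀ q, HasDerivAt g (∑ i, c i * Real.exp (q * b i) * b i) q := fun q => by
    refine HasDerivAt.fun_sum fun i _ => ?_
    have := (((hasDerivAt_id q).mul_const (b i)).exp).const_mul (c i)
    simpa [mul_assoc] using this
  have hcoer : Tendsto g atBot atTop := tendsto_atTop_mono (fun q =>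
    Finset.single_le_sum (f := fun i => c i * Real.exp (q * b i))
      (fun i _ => (mul_pos (hc i) (Real.exp_pos _)).le) (Finset.mem_univ j))
    (tendsto_mul_exp_atBot (hc j) hj)
  -- A minimum on the closed half-line exists since the sum tends to infinity at `-∞`. It is either
  -- interior, with zero derivative, or at `0`, with nonpositive left derivative.
  obtain ⟨q, hq0, hq⟩ := (continuous_iff_continuousAt.2 fun q =>
    (hderiv q).continuousAt).continuousOn.exists_isMinOn' (s := Set.Iic (0 : ℝ)) isClosed_Iic
      (Set.self_mem_Iic) (by
        rw [cocompact_eq_atBot_atTop, inf_sup_right, eventually_sup]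
        refine ⟨(hcoer.eventually_ge_atTop _).filter_mono inf_le_left, ?_⟩
        rw [eventually_inf_principal]
        filter_upwards [eventually_gt_atTop 0] with x hx hx'
        exact absurd hx' (not_le.2 hx))
  refine ⟨q, hq0, ?_⟩
  rcases (Set.mem_Iic.1 hq0).lt_or_eq with h | h
  · have := (hq.isLocalMin (Iic_mem_nhds h)).hasDerivAt_eq_zero (hderiv q)
    exact ⟨this.le, by rw [this, mul_zero]⟩
  · refine ⟨?_, by rw [h, zero_mul]⟩
    have hslope := ((hasDerivAt_iff_tendsto_slope_left_right.1 (hderiv q)).1)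
    refine le_of_tendsto hslope ?_
    filter_upwards [self_mem_nhdsWithin] with x hx
    have hx' : x < q := hx
    rw [slope_def_field]
    exact div_nonpos_of_nonneg_of_nonpos (sub_nonneg.2 (hq (hx'.le.trans hq0))) (by linarith)

/-- Weights of large entropy relative to `p` whose dimension exceeds `s`, if `s` is less than all
values of the pressure on the negative half-line. -/
theorem exists_weights [NeZero N] (h0 : ∀ i, 0 < lam i)
    (h1 : ∀ i, lam i < 1) (hp : ∀ i, 0 < p i) {α s s' : ℝ} (hss : s < s')
    (hi : ∃ i, Real.log (p i) + α < 0) (hP : ∀ q < 0, s' ≤ pressure lam p α q) :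
    ∃ m : Fin N → ℝ, (∀ i, 0 < m i) ∧ ∑ i, m i = 1 ∧ α < -∑ i, m i * Real.log (p i) ∧
      ∑ i, m i * (Real.log (m i) - s * Real.log (lam i)) < 0 := by
  -- The first-order condition yields only a weak inequality for the entropy; passing to `α' > α`
  -- makes it strict.
  obtain ⟨α', hα', hi', hone⟩ := exists_gt_forall_one_lt_pressureSum h0 h1 hp hss hi fun q hq =>
    not_lt.1 fun h => absurd ((pressureSum_lt_one_iff h0 h1 hp).1 h) (not_lt.2 (hP q hq))
  have hc : ∀ i, 0 < lam i ^ s := fun i => Real.rpow_pos_of_pos (h0 i) s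
  obtain ⟨q, hq0, hd, hqd⟩ := exists_nonpos_sum_exp_deriv hc hi'
  have hg := hone q hq0
  rw [pressureSum_eq_sum_exp hp] at hg
  set w : Fin N → ℝ := fun i => lam i ^ s * Real.exp (q * (Real.log (p i) + α')) with hw
  have hw0 : ∀ i, 0 < w i := fun i => mul_pos (hc i) (Real.exp_pos _)
  set G := ∑ i, w i with hG
  have hG0 : 0 < G := by linarith
  have hsum1 : ∑ i, w i / G = 1 := by rw [← Finset.sum_div, div_self hG0.ne']
  have hdG : ∑ i, w i / G * (Real.log (p i) + α') = (∑ i, w i * (Real.log (p i) + α')) / G := by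
    rw [Finset.sum_div]; exact Finset.sum_congr rfl fun i _ => by ring
  refine ⟨fun i => w i / G, fun i => div_pos (hw0 i) hG0, hsum1, ?_, ?_⟩
  · have h2 : ∑ i, w i / G * (Real.log (p i) + α') ≤ 0 := by
      rw [hdG]; exact div_nonpos_of_nonpos_of_nonneg hd hG0.le
    simp only [mul_add, Finset.sum_add_distrib, ← Finset.sum_mul, hsum1] at h2
    linarith
  · have hlog : ∀ i, Real.log (w i / G) - s * Real.log (lam i)
        = q * (Real.log (p i) + α') - Real.log G := fun i => by
      rw [Real.log_div (hw0 i).ne' hG0.ne', Real.log_mul (hc i).ne' (Real.exp_pos _).ne',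
        Real.log_rpow (h0 i), Real.log_exp]; ring
    -- The term linear in `q` vanishes by the first-order condition, so the sum reduces to `-log G`
    -- with `G > 1`.
    have h2 : q * ∑ i, w i / G * (Real.log (p i) + α') = 0 := by
      rw [hdG, ← mul_div_assoc, hqd, zero_div]
    calc ∑ i, w i / G * (Real.log (w i / G) - s * Real.log (lam i))
        = q * ∑ i, w i / G * (Real.log (p i) + α') - (∑ i, w i / G) * Real.log G := by
          rw [Finset.mul_sum, Finset.sum_mul, ← Finset.sum_sub_distrib]
          exact Finset.sum_congr rfl fun i _ => by rw [hlog]; ring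
      _ = -Real.log G := by rw [h2, hsum1]; ring
      _ < 0 := neg_neg_of_pos (Real.log_pos hg)

end Pressure

/-! ### The uncovered set -/

section Covering

variable {d N : ℕ} {f : Fin N → RSpace d → RSpace d} {lam p : Fin N → ℝ}

/-- A sequence which is covered only finitely often has infinitely many initial segments of small
probability, if all words of large probability are hit in time. -/
theorem frequently_wordProd_lt_of_not_covered {l : ℕ → ℕ} (hl : Monotone l)
    (hltop : Tendsto l atTop atTop) {a b : ℝ}
    (hfreq : ∃ᶠ n : ℕ in atTop, b * l n ≤ Real.log n) {o : SymbolSpace N}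
    (hhit : ∀ᶠ m : ℕ in atTop, ∀ ω : SymbolSpace N, Real.exp (-(a * m)) ≤ wordProd p ω m →
      ∃ n : ℕ, m ≤ n ∧ (n : ℝ) ≤ Real.exp (b * m) ∧ shift^[n] o ∈ PiNat.cylinder ω m)
    {ω : SymbolSpace N} (hω : ¬ ∃ᶠ n in atTop, ω ∈ PiNat.cylinder (shift^[n] o) (l n)) :
    ∃ᶠ m : ℕ in atTop, wordProd p ω m < Real.exp (-(a * m)) := by
  by_contra hnot
  refine hω (frequently_atTop.2 fun M => ?_)
  simp only [not_frequently, not_lt] at hnot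
  obtain ⟨n, hn, ⟨⟨h1, h2⟩, h3⟩, hn1⟩ := (hfreq.and_eventually
    ((((hltop.eventually hhit).and (hltop.eventually hnot)).and
      (hltop.eventually (eventually_ge_atTop M))).and (eventually_gt_atTop 0))).exists
  obtain ⟨k, hk1, hk2, hk3⟩ := h1 ω h2
  have hkn : k ≤ n := by
    have h4 : Real.exp (b * l n) ≤ n := by
      rwa [← Real.le_log_iff_exp_le (by exact_mod_cast hn1)]
    exact_mod_cast hk2.trans h4
  -- The word `ω|l(n)` is hit at a time `k ≤ n`, where the required length `l k` is at most `l n`.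
  exact ⟨k, h3.trans hk1, PiNat.cylinder_anti _ (hl hkn)
    ((PiNat.mem_cylinder_comm _ _ _).1 hk3)⟩

theorem eventually_mul_log_le_of_liminf {l : ℕ → ℕ} {x c : ℝ} (hc : c < x)
    (hlim : liminf (fun n : ℕ => (((l n : ℝ) / Real.log n : ℝ) : EReal)) atTop = (x : EReal)) :
    ∀ᶠ n : ℕ in atTop, c * Real.log n ≤ l n := by
  have h := eventually_lt_of_lt_liminf (f := atTop) (b := (c : EReal))
    (hlim ▸ EReal.coe_lt_coe_iff.2 hc)
  filter_upwards [h, eventually_gt_atTop 1] with n hn hn1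
  rw [EReal.coe_lt_coe_iff, lt_div_iff₀ (Real.log_pos (by exact_mod_cast hn1))] at hn
  exact hn.le

/-- The lower limit bounds `l` from above only along infinitely many `n`. This is enough, since each
such `n` produces one covering time that is at least `l n`. -/
theorem frequently_mul_le_log_of_liminf {l : ℕ → ℕ} {x b : ℝ} (hb : 0 < b) (hbx : x < 1 / b)
    (hlim : liminf (fun n : ℕ => (((l n : ℝ) / Real.log n : ℝ) : EReal)) atTop = (x : EReal)) :
    ∃ᶠ n : ℕ in atTop, b * l n ≤ Real.log n := by
  have h := frequently_lt_of_liminf_lt (f := atTop) (b := ((1 / b : ℝ) : EReal))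
    (h := hlim ▸ EReal.coe_lt_coe_iff.2 hbx)
  refine (h.and_eventually (eventually_gt_atTop 1)).mono fun n ⟨hn, hn1⟩ => ?_
  rw [EReal.coe_lt_coe_iff, div_lt_div_iff₀ (Real.log_pos (by exact_mod_cast hn1)) hb] at hn
  linarith

theorem tendsto_atTop_of_liminf_pos {l : ℕ → ℕ} {x : ℝ} (hx : 0 < x)
    (hlim : liminf (fun n : ℕ => (((l n : ℝ) / Real.log n : ℝ) : EReal)) atTop = (x : EReal)) :
    Tendsto l atTop atTop := by
  rw [← tendsto_natCast_atTop_iff (R := ℝ)]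
  exact tendsto_atTop_mono' _ (eventually_mul_log_le_of_liminf (half_lt_self hx) hlim)
    ((Real.tendsto_log_atTop.comp tendsto_natCast_atTop_atTop).const_mul_atTop (half_pos hx))

/-- Almost surely, every sequence which is covered only finitely often has, for all `a < α`,
infinitely many initial segments of probability less than `e^{-am}`. -/
theorem ae_frequently_wordProd_lt_of_not_covered [NeZero N] (hp : ∀ i, 0 < p i)
    (hp1 : ∑ i, p i = 1) {α : ℝ} (hα : 0 < α) {l : ℕ → ℕ} (hl : Monotone l)
    (hlim : liminf (fun n : ℕ => (((l n : ℝ) / Real.log n : ℝ) : EReal)) atTop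
      = ((1 / α : ℝ) : EReal)) :
    ∀ᵐ o ∂(bernoulliMeasure p), ∀ ω : SymbolSpace N,
      ¬ (∃ᶠ n in atTop, ω ∈ PiNat.cylinder (shift^[n] o) (l n)) → ∀ a, 0 ≤ a → a < α →
        ∃ᶠ m : ℕ in atTop, wordProd p ω m < Real.exp (-(a * m)) := by
  -- Rational parameters give one null set for all `a`.
  have hhit : ∀ᵐ o ∂(bernoulliMeasure p), ∀ a b : ℚ, (0 : ℝ) ≤ a ∧ (a : ℝ) < b →
      ∀ᶠ m : ℕ in atTop, ∀ ω : SymbolSpace N, Real.exp (-(a * m)) ≤ wordProd p ω m →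
        ∃ n : ℕ, m ≤ n ∧ (n : ℝ) ≤ Real.exp (b * m) ∧ shift^[n] o ∈ PiNat.cylinder ω m :=
    ae_all_iff.2 fun a => ae_all_iff.2 fun b => eventually_imp_distrib_left.2 fun h =>
      ae_eventually_forall_exists_hit hp hp1 h.1 h.2
  filter_upwards [hhit] with o ho ω hω a ha haα
  obtain ⟨a', haa', ha'α⟩ := exists_rat_btwn haα
  obtain ⟨b, hab, hbα⟩ := exists_rat_btwn ha'α
  have hb0 : (0 : ℝ) < b := by linarith
  refine (frequently_wordProd_lt_of_not_covered hl (tendsto_atTop_of_liminf_pos (by positivity)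
    hlim) (frequently_mul_le_log_of_liminf hb0 (one_div_lt_one_div_of_lt hb0 hbα) hlim)
    (ho a' b ⟨by linarith, hab⟩) hω).mono fun m hm => hm.trans_le (Real.exp_le_exp.2 ?_)
  have : a * m ≤ a' * m := by gcongr
  linarith

/-- If the weights `m` give large entropy relative to `p`, then for almost every `o`, almost every
sequence is covered only finitely often. -/
theorem ae_ae_not_covered_of_lt (hp : ∀ i, 0 < p i) (hp1 : ∑ i, p i = 1)
    {α : ℝ} (hα : 0 < α) {l : ℕ → ℕ}
    (hlim : liminf (fun n : ℕ => (((l n : ℝ) / Real.log n : ℝ) : EReal)) atTop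
      = ((1 / α : ℝ) : EReal))
    {m : Fin N → ℝ} (hm : ∀ i, 0 < m i) (hm1 : ∑ i, m i = 1)
    (hmα : α < -∑ i, m i * Real.log (p i)) :
    ∀ᵐ o ∂(bernoulliMeasure p), ∀ᵐ ω ∂(bernoulliMeasure m),
      ¬ ∃ᶠ n in atTop, ω ∈ PiNat.cylinder (shift^[n] o) (l n) := by
  obtain ⟨a, hαa, ha⟩ := exists_between hmα
  have ha0 : 0 < a := hα.trans hαa
  obtain ⟨c, hc, hc'⟩ := exists_between (one_div_lt_one_div_of_lt hα hαa)
  rw [div_lt_iff₀ ha0] at hc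
  exact ae_ae_not_frequently_mem_cylinder_shift hp hp1 hm hm1 ha0 (by rwa [mul_comm])
    (eventually_mul_log_le_of_liminf hc' hlim) ha

/-- Only this inclusion is general: an uncovered sequence may project to a point with another,
covered coding. It is all that the upper bounds need. -/
theorem dynamicalCoveringSet_compl_subset {L : Set (RSpace d)} (hL : Set.range (codingMap f) = L)
    (o : SymbolSpace N) (l : ℕ → ℕ) :
    L \ dynamicalCoveringSet f o l
      ⊆ codingMap f '' {ω | ¬ ∃ᶠ n in atTop, ω ∈ PiNat.cylinder (shift^[n] o) (l n)} := by
  rintro x ⟨hx, hxR⟩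
  rw [← hL] at hx
  obtain ⟨ω, rfl⟩ := hx
  exact ⟨ω, fun h => hxR ⟨ω, h, rfl⟩, rfl⟩

/-- Weights of large entropy relative to `p` give a lower bound for the dimension of the uncovered
set. -/
theorem ae_le_dimH_compl_of_weights [NeZero N] (hosc : OpenSetCondition f)
    (h0 : ∀ i, 0 < lam i) (h1 : ∀ i, lam i < 1) (hf : ∀ i, IsSimilarity (f i) (lam i))
    {L : Set (RSpace d)} (hL : IsAttractor f L) (hp : ∀ i, 0 < p i) (hp1 : ∑ i, p i = 1)
    {α : ℝ} (hα : 0 < α) {l : ℕ → ℕ}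
    (hlim : liminf (fun n : ℕ => (((l n : ℝ) / Real.log n : ℝ) : EReal)) atTop
      = ((1 / α : ℝ) : EReal))
    {m : Fin N → ℝ} (hm : ∀ i, 0 < m i) (hm1 : ∑ i, m i = 1)
    (hmα : α < -∑ i, m i * Real.log (p i)) {s : ℝ≥0}
    (hms : ∑ i, m i * (Real.log (m i) - s * Real.log (lam i)) < 0) :
    ∀ᵐ o ∂(bernoulliMeasure p), (s : ℝ≥0∞) ≤ dimH (L \ dynamicalCoveringSet f o l) := by
  have hb := (isCompact_range_codingMap h0 h1 hf hL).isBounded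
  have hrange := range_codingMap h0 h1 hf hL
  obtain ⟨ω₀, n₀, huniq⟩ := hosc.exists_word_unique_coding h0 h1 hf hb
  filter_upwards [ae_ae_not_covered_of_lt hp hp1 hα hlim hm hm1 hmα] with o ho
  refine le_dimH_of_ae_mem hosc h0 h1 hf hb hm hm1 ?_ ?_
  · filter_upwards [eventually_sum_letters_le hm hm1
      (fun i => Real.log (m i) - s * Real.log (lam i)) hms] with ω hω
    filter_upwards [hω] with n hn
    rw [Finset.sum_sub_distrib, ← Finset.mul_sum, ← log_wordProd hm, ← log_wordProd h0, zero_mul,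
      sub_nonpos] at hn
    rwa [← Real.log_le_log_iff (wordProd_pos hm ω n) (Real.rpow_pos_of_pos (wordProd_pos h0 ω n) _),
      Real.log_rpow (wordProd_pos h0 ω n)]
  · filter_upwards [ho, ae_forall_frequently_shift_mem_cylinder hm hm1] with ω hω hfreq
    refine ⟨hrange ▸ ⟨ω, rfl⟩, ?_⟩
    -- If the point were covered through a coding `η`, uniqueness would give `η = ω`.
    rintro ⟨η, hη, hηω⟩
    rw [huniq ω (hfreq ω₀ n₀) η hηω] at hη
    exact hω hη

/-- The weights and the exceptional null set depend on `s`, so the bound is taken over countably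
many rational `s < s'` below the infimum. Nonpositive `s` are irrelevant because a dimension is
nonnegative. -/
theorem ae_le_dimH_compl_of_le_pressure [NeZero N] (hosc : OpenSetCondition f)
    (h0 : ∀ i, 0 < lam i) (h1 : ∀ i, lam i < 1) (hf : ∀ i, IsSimilarity (f i) (lam i))
    {L : Set (RSpace d)} (hL : IsAttractor f L) (hp : ∀ i, 0 < p i) (hp1 : ∑ i, p i = 1)
    {α : ℝ} (hα : 0 < α) {l : ℕ → ℕ}
    (hlim : liminf (fun n : ℕ => (((l n : ℝ) / Real.log n : ℝ) : EReal)) atTop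
      = ((1 / α : ℝ) : EReal)) (hi : ∃ i, Real.log (p i) + α < 0) :
    ∀ᵐ o ∂(bernoulliMeasure p),
      (⨅ q ∈ Set.Iio (0 : ℝ), (pressure lam p α q : EReal))
        ≤ (dimH (L \ dynamicalCoveringSet f o l) : EReal) := by
  have hae : ∀ᵐ o ∂(bernoulliMeasure p), ∀ s s' : ℚ,
      ((0 : ℝ) < s ∧ (s : ℝ) < s' ∧ ∀ q < 0, (s' : ℝ) ≤ pressure lam p α q) →
        ((s : ℝ).toNNReal : ℝ≥0∞) ≤ dimH (L \ dynamicalCoveringSet f o l) := by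
    refine ae_all_iff.2 fun s => ae_all_iff.2 fun s' => eventually_imp_distrib_left.2 ?_
    rintro ⟨hs, hss, hP⟩
    obtain ⟨m, hm, hm1, hmα, hms⟩ := exists_weights h0 h1 hp hss hi hP
    refine ae_le_dimH_compl_of_weights hosc h0 h1 hf hL hp hp1 hα hlim hm hm1 hmα ?_
    rwa [Real.coe_toNNReal _ hs.le]
  filter_upwards [hae] with o ho
  by_contra! hlt
  obtain ⟨s, hs1, hs2⟩ := EReal.lt_iff_exists_rat_btwn.1 hlt
  obtain ⟨s', hss', hs'2⟩ := EReal.lt_iff_exists_rat_btwn.1 hs2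
  have hs0 : (0 : ℝ) < s := by
    have h := (EReal.coe_ennreal_nonneg _).trans_lt hs1
    exact_mod_cast h
  have h := ho s s' ⟨hs0, EReal.coe_lt_coe_iff.1 hss', fun q hq =>
    EReal.coe_le_coe_iff.1 (hs'2.le.trans (iInf₂_le q hq))⟩
  refine absurd hs1 (not_lt.2 ?_)
  have h2 : (((s : ℝ).toNNReal : ℝ≥0∞) : EReal) ≤ _ := EReal.coe_ennreal_le_coe_ennreal_iff.2 h
  have h3 : (((s : ℝ).toNNReal : ℝ≥0∞) : EReal) = ((s : ℝ) : EReal) := by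
    change ((ENNReal.ofReal (s : ℝ) : ℝ≥0∞) : EReal) = _
    rw [EReal.coe_ennreal_ofReal, max_eq_left hs0.le]
  rwa [h3] at h2

/-- If infinitely many initial segments of every uncovered sequence have small probability, then
the pressure bounds the dimension of the uncovered set. -/
theorem dimH_compl_le_pressure [NeZero N]
    (h0 : ∀ i, 0 < lam i) (h1 : ∀ i, lam i < 1) (hf : ∀ i, IsSimilarity (f i) (lam i))
    {L : Set (RSpace d)} (hL : IsAttractor f L) (hp : ∀ i, 0 < p i)
    {α : ℝ} (hα : 0 < α) {l : ℕ → ℕ} {o : SymbolSpace N}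
    (ho : ∀ ω : SymbolSpace N,
      ¬ (∃ᶠ n in atTop, ω ∈ PiNat.cylinder (shift^[n] o) (l n)) → ∀ a, 0 ≤ a → a < α →
        ∃ᶠ m : ℕ in atTop, wordProd p ω m < Real.exp (-(a * m)))
    {q : ℝ} (hq : q < 0) (hP : 0 ≤ pressure lam p α q) :
    dimH (L \ dynamicalCoveringSet f o l) ≤ ENNReal.ofReal (pressure lam p α q) := by
  have hb := (isCompact_range_codingMap h0 h1 hf hL).isBounded
  refine dimH_le fun s hs => ?_
  by_contra! hlt
  rw [← ENNReal.ofReal_coe_nnreal, ENNReal.ofReal_lt_ofReal_iff_of_nonneg hP,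
    ← pressureSum_lt_one_iff h0 h1 hp] at hlt
  have hs0 : (0 : ℝ) < s := by
    rw [pressureSum_lt_one_iff h0 h1 hp] at hlt; exact hP.trans_lt hlt
  have hcont : Tendsto (fun a => pressureSum lam p a q s) (𝓝[<] α)
      (𝓝 (pressureSum lam p α q s)) := by
    have : Continuous fun a => pressureSum lam p a q s := by
      simp only [pressureSum_eq_sum_exp hp]; fun_prop
    exact (this.tendsto α).mono_left nhdsWithin_le_nhds
  -- Initial segments are controlled only for `a < α`; continuity in `a` keeps the pressure sum
  -- below `1`.
  obtain ⟨a, ha, ha0, haα⟩ := ((hcont.eventually (gt_mem_nhds hlt)).and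
    (Ioo_mem_nhdsLT hα)).exists
  have hnull := hausdorffMeasure_frequently_lt_eq_zero h0 h1 hf hb hp hs0 hq.le ha
  have hsub : L \ dynamicalCoveringSet f o l ⊆ codingMap f ''
      {ω | ∃ᶠ m : ℕ in atTop, wordProd p ω m < Real.exp (-(a * m))} :=
    (dynamicalCoveringSet_compl_subset (range_codingMap h0 h1 hf hL) o l).trans
      (Set.image_mono fun ω hω => ho ω hω a ha0.le haα)
  exact ENNReal.zero_ne_top ((measure_mono_null hsub hnull).symm.trans hs)

/-- The dimension of the attractor is the similarity dimension. -/
theorem dimH_attractor [NeZero N] (hosc : OpenSetCondition f)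
    (h0 : ∀ i, 0 < lam i) (h1 : ∀ i, lam i < 1) (hf : ∀ i, IsSimilarity (f i) (lam i))
    {L : Set (RSpace d)} (hL : IsAttractor f L) {t : ℝ≥0} (hsum : ∑ i, lam i ^ (t : ℝ) = 1) :
    dimH L = t := by
  have hb := (isCompact_range_codingMap h0 h1 hf hL).isBounded
  have hrange := range_codingMap h0 h1 hf hL
  have hlt : ∀ i, 0 < lam i ^ (t : ℝ) := fun i => Real.rpow_pos_of_pos (h0 i) _
  have := isProbabilityMeasure_bernoulliMeasure (p := fun i => lam i ^ (t : ℝ)) hlt hsum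
  refine le_antisymm (dimH_le_of_hausdorffMeasure_ne_top ?_) ?_
  · have h := hausdorffMeasure_image_codingMap_le h0 h1 hf hb t.coe_nonneg hsum Set.univ
    rw [Set.image_univ, hrange] at h
    exact (h.trans_lt (ENNReal.mul_lt_top ENNReal.ofReal_lt_top (measure_lt_top _ _))).ne
  · refine le_dimH_of_ae_mem hosc h0 h1 hf hb hlt hsum ?_ ?_
    · exact .of_forall fun ω => .of_forall fun n => (wordProd_rpow h0 _ ω n).le
    · exact .of_forall fun ω => hrange ▸ ⟨ω, rfl⟩

/-- At `q = 0` the probabilities drop out of the pressure sum, so `lam` stands in for `p`. A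
negative exponent would make a single term exceed `1`. -/
theorem exists_sum_rpow_eq_one [NeZero N] (h0 : ∀ i, 0 < lam i) (h1 : ∀ i, lam i < 1) :
    ∃ t : ℝ≥0, ∑ i, lam i ^ (t : ℝ) = 1 := by
  have h := pressureSum_pressure (p := lam) h0 h1 h0 0 0
  simp only [pressureSum, Real.rpow_zero, mul_one] at h
  refine ⟨⟨pressure lam lam 0 0, ?_⟩, h⟩
  by_contra! hlt
  have h2 : 1 < lam 0 ^ pressure lam lam 0 0 :=
    Real.one_lt_rpow_of_pos_of_lt_one_of_neg (h0 0) (h1 0) hlt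
  rw [← h] at h2
  exact absurd h2 (not_lt.2 (Finset.single_le_sum
    (f := fun i => lam i ^ pressure lam lam 0 0)
    (fun i _ => (Real.rpow_pos_of_pos (h0 i) _).le) (Finset.mem_univ 0)))

end Covering

theorem theorem1p3 {d N : ℕ} (f : Fin N → RSpace d → RSpace d) (lam : Fin N → ℝ)
    (hlam0 : ∀ i, 0 < lam i) (hlam1 : ∀ i, lam i < 1)
    (hf : ∀ i, IsSimilarity (f i) (lam i)) (hosc : OpenSetCondition f)
    (L : Set (RSpace d)) (hL : IsAttractor f L)
    (s₀ : ℝ≥0) (hs₀ : dimH L = s₀)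
    (p : Fin N → ℝ) (hp : ∀ i, 0 < p i) (hp1 : ∑ i, p i = 1)
    (α : ℝ) (hα : 0 < α)
    (l : ℕ → ℕ) (hl : Monotone l)
    (hlim : liminf (fun n : ℕ => (((l n : ℝ) / Real.log n : ℝ) : EReal)) atTop
      = ((1 / α : ℝ) : EReal)) :
    ∀ᵐ o ∂(bernoulliMeasure p),
      (α < -Real.log (minProb p) →
        (dimH (L \ dynamicalCoveringSet f o l) : EReal)
          = ⨅ q ∈ Set.Iio (0 : ℝ), (pressure lam p α q : EReal)) ∧
      (α < -∑ i, lam i ^ (s₀ : ℝ) * Real.log (p i) →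
        μH[(s₀ : ℝ)] (L \ dynamicalCoveringSet f o l) = μH[(s₀ : ℝ)] L) ∧
      (-Real.log (minProb p) < α →
        L \ dynamicalCoveringSet f o l = ∅ ∧
          (⨅ q ∈ Set.Iio (0 : ℝ), (pressure lam p α q : EReal)) = ⊥) := by
  have hN : NeZero N := ⟨fun h => by subst h; simp at hp1⟩
  have hb := (isCompact_range_codingMap hlam0 hlam1 hf hL).isBounded
  have hrange := range_codingMap hlam0 hlam1 hf hL
  obtain ⟨i₀, hi₀⟩ := Finite.exists_min p
  have hmin : minProb p = p i₀ :=
    le_antisymm (ciInf_le (Set.finite_range p).bddBelow i₀) (le_ciInf hi₀)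
  rw [hmin]
  -- Identifies `s₀` with the similarity dimension, so that `λ_i^{s₀}` is a probability vector.
  have hsum : ∑ i, lam i ^ (s₀ : ℝ) = 1 := by
    obtain ⟨t, ht⟩ := exists_sum_rpow_eq_one hlam0 hlam1
    have h := (dimH_attractor hosc hlam0 hlam1 hf hL ht).symm.trans hs₀
    rwa [← ENNReal.coe_inj.1 h]
  refine Eventually.and ?_ (Eventually.and ?_ ?_)
  · rw [eventually_imp_distrib_left]
    intro hα1
    have hi : ∃ i, Real.log (p i) + α < 0 := ⟨i₀, by linarith⟩
    filter_upwards [ae_frequently_wordProd_lt_of_not_covered hp hp1 hα hl hlim,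
      ae_le_dimH_compl_of_le_pressure hosc hlam0 hlam1 hf hL hp hp1 hα hlim hi] with o ho ho'
    refine le_antisymm (le_iInf₂ fun q hq => ?_) ho'
    have hP : 0 < pressure lam p α q := pressure_pos hlam0 hlam1 hp hq ⟨i₀, by
      rw [← Real.exp_log (hp i₀), ← Real.exp_add, Real.exp_lt_one_iff]; linarith⟩
    have h := EReal.coe_ennreal_le_coe_ennreal_iff.2
      (dimH_compl_le_pressure hlam0 hlam1 hf hL hp hα ho hq hP.le)
    rwa [EReal.coe_ennreal_ofReal, max_eq_left hP.le] at h
  · rw [eventually_imp_distrib_left]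
    intro hα2
    filter_upwards [ae_ae_not_covered_of_lt hp hp1 hα hlim
      (fun i => Real.rpow_pos_of_pos (hlam0 i) _) hsum hα2] with o ho
    -- It suffices that the covering set itself is null, and it is the projection of the sequences
    -- covered infinitely often.
    refine measure_sdiff_null (nonpos_iff_eq_zero.1 ?_)
    refine (hausdorffMeasure_image_codingMap_le hlam0 hlam1 hf hb s₀.coe_nonneg hsum _).trans ?_
    have hnull : bernoulliMeasure (fun i => lam i ^ (s₀ : ℝ))
        {ω | ∃ᶠ n in atTop, ω ∈ PiNat.cylinder (shift^[n] o) (l n)} = 0 := by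
      rw [measure_eq_zero_iff_ae_notMem]; exact ho
    exact (mul_eq_zero_of_right _ hnull).le
  · rw [eventually_imp_distrib_left]
    intro hα3
    have hp_le : p i₀ ≤ 1 :=
      hp1 ▸ Finset.single_le_sum (fun i _ => (hp i).le) (Finset.mem_univ i₀)
    filter_upwards [ae_frequently_wordProd_lt_of_not_covered hp hp1 hα hl hlim] with o ho
    refine ⟨?_, ?_⟩
    · rw [Set.eq_empty_iff_forall_notMem]
      intro x hx
      obtain ⟨ω, hω, -⟩ := dynamicalCoveringSet_compl_subset hrange o l hx
      -- With `a = -log p_min` the threshold is `p_min^m`, and no word of length `m` has smaller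
      -- probability.
      obtain ⟨m, hm⟩ := (ho ω hω (-Real.log (p i₀))
        (by linarith [Real.log_nonpos (hp i₀).le hp_le]) hα3).exists
      refine absurd hm (not_lt.2 ?_)
      rw [neg_mul, neg_neg, mul_comm, Real.exp_nat_mul, Real.exp_log (hp i₀),
        ← wordProd_const (p i₀) ω m]
      exact wordProd_mono (fun _ => (hp i₀).le) hi₀ ω m
    · rw [EReal.eq_bot_iff_forall_lt]
      intro y
      obtain ⟨q, hq, hqy⟩ := exists_pressure_lt hlam0 hlam1 hp (α := α) (fun i => by
        rw [← Real.exp_log (hp i), ← Real.exp_add, Real.one_lt_exp_iff]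
        linarith [Real.log_le_log (hp i₀) (hi₀ i)]) y
      exact (iInf₂_le q hq).trans_lt (EReal.coe_lt_coe_iff.2 hqy)
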